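/- **Full abstraction of the bistable bicpo semantics of SPCF.** *Language.* The types of SPCF are $S,T ::= \Sigma \mid \mathtt{nat} \mid S\Rightarrow T \mid S\times T$; for $n\ge 1$, $\Sigma^n$ denotes the $n$-fold product of $\Sigma$. Terms are those of the simply-typed $\lambda$-calculus with pairing $\langle M,N\rangle$, projections $\pi_1:S\times T\Rightarrow S$, $\pi_2:S\times T\Rightarrow T$ and constants $\top,\bot:\Sigma$; $\mathtt{0}:\mathtt{nat}$; $\mathtt{succ},\mathtt{pred}:\mathtt{nat}\Rightarrow\mathtt{nat}$; $\mathtt{IF0}:\mathtt{nat}\Rightarrow(T\times T)\Rightarrow T$ for $T\in\{\Sigma,\mathtt{nat}\}$; $\mathbf{Y}:(T\Rightarrow T)\Rightarrow T$ for every type $T$; and $\mathtt{catch}_n:(\Sigma^n\Rightarrow\Sigma)\Rightarrow\mathtt{nat}$ for every $n\ge 1$. Write $\mathtt{n}$ for the numeral $\mathtt{succ}^n\,\mathtt{0}$. *Operational semantics.* Evaluation contexts are $E ::= [\cdot]\mid E\,M\mid \mathtt{IF0}\,E\mid \pi_i\,E\mid\mathtt{succ}\,E\mid\mathtt{pred}\,E$.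 Programs are closed terms of type $\Sigma$; they reduce by $E[\top]\to\top$; $E[(\lambda x.M)N]\to E[M[N/x]]$; $E[\pi_i\langle M_1,M_2\rangle]\to E[M_i]$; $E[\mathtt{pred}(\mathtt{succ}\,\mathtt{n})]\to E[\mathtt{n}]$; $E[\mathtt{IF0}\,\mathtt{0}]\to E[\pi_1]$; $E[\mathtt{IF0}(\mathtt{succ}\,\mathtt{n})]\to E[\pi_2]$; $E[\mathtt{catch}_n M]\to M\langle E[\mathtt{0}],\dots,E[\mathtt{n-1}]\rangle$; $E[\mathbf{Y}M]\to E[M(\mathbf{Y}M)]$. Write $P\Downarrow$ if the program $P$ reduces in finitely many steps to $\top$. For terms $M,N$ (possibly open) of the same type in the same typing context, $M\lesssim N$ means that for every context $C[\cdot]$ (which may bind variables of the term put into it) such that $C[M]$ and $C[N]$ are programs, $C[M]\Downarrow$ implies $C[N]\Downarrow$. *Semantics.* A *bistable biorder* is a partial order $(D,\le^E)$ with an equivalence relation $\updownarrow$ each of whose classes is a distributive lattice for $\le^E$, with inclusion into $D$ preserving binary meets and joins. For directed (non-empty) sets, $X\updownarrow Y$ means that for all $x\in X,y\in Y$ there are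 $x'\in X,y'\in Y$ with $x\le^E x'$, $y\le^E y'$, $x'\updownarrow y'$. A *bistable bicpo* is a bistable biorder in which directed sets have suprema and $X\updownarrow Y$ implies $\bigsqcup X\updownarrow\bigsqcup Y$ and $\bigsqcup X\wedge\bigsqcup Y=\bigsqcup\{x\wedge y\mid x\in X,\,y\in Y,\,x\updownarrow y\}$. Morphisms are the functions that preserve directed suprema, coherence $\updownarrow$, and the meets and joins of coherent pairs. Products, and the one-point terminal object, are componentwise; $D\Rightarrow E$ is the set of morphisms, with $f\le^E g$ iff $f(x)\le^E g(x)$ for all $x$, and $f\updownarrow g$ iff $f(x)\updownarrow g(x)$ for all $x$ and, whenever $x\updownarrow y$, $f(x)\wedge g(y)=f(y)\wedge g(x)$ and $f(x)\vee g(y)=f(y)\vee g(x)$. This gives a cartesian closed category. For a set $X$, $X^\top_\bot$ is $X\cup\{\bot,\top\}$ with $x\le^E y$ iff $x=\bot$ or $y=\top$ or $x=y$, and $x\updownarrow y$ iff $x=y$ or $x,y\in\{\bot,\top\}$. Put $[\![\Sigma]\!]=\emptyset^\top_\bot=\{\bot,\top\}$ and $[\![\mathtt{nat}]\!]=\mathbb{N}^\top_\bot$,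 and interpret $\times$, $\Rightarrow$, typing contexts and $\lambda$-terms by the cartesian closed structure, so that a term of type $T$ in typing context $\Gamma$ denotes a morphism $[\![\Gamma]\!]\to[\![T]\!]$. The constants $\top,\bot,\mathtt{0}$ denote $\top,\bot,0$. The constants $\mathtt{succ},\mathtt{pred},\mathtt{IF0}$ denote the functions preserving $\bot$ and $\top$ with $\mathtt{succ}(n)=n+1$, $\mathtt{pred}(n+1)=n$, $\mathtt{pred}(0)=\bot$, $\mathtt{IF0}(0)=\pi_1$, $\mathtt{IF0}(n+1)=\pi_2$. The constant $\mathbf{Y}$ denotes $\bigsqcup_{i}F^i(\bot)$, where $F=\lambda f.\lambda g.g(f\,g)$. Finally $\mathtt{catch}_n$ denotes the function that sends the constant functions $\bot,\top$ to $\bot,\top$ and the $i$-th projection $\Sigma^n\Rightarrow\Sigma$ (counted from $0$) to $i$; every element of $[\![\Sigma^n\Rightarrow\Sigma]\!]$ is one of these. **Theorem.** For all SPCF terms $M,N$ of the same type in the same typing context, $$M\lesssim N\quad\Longleftrightarrow\quad[\![M]\!]\le^E[\![N]\!].$$ -/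

import Mathlib

namespace SPCF

/-! ## Bistable biorders and bistable bicpos -/

section Bounds

variable {D : Type*} [PartialOrder D]

open Classical in
/-- The binary greatest lower bound `x ∧ y` in a partial order (used only where it exists). -/
noncomputable def bmeet (x y : D) : D :=
  if h : ∃ m, IsGLB {x, y} m then h.choose else x

open Classical in
/-- The binary least upper bound `x ∨ y` in a partial order (used only where it exists). -/
noncomputable def bjoin (x y : D) : D :=
  if h : ∃ m, IsLUB {x, y} m then h.choose else x

theorem bmeet_eq_of_isGLB {x y m : D} (h : IsGLB {x, y} m) : bmeet x y = m := by
  have hex : ∃ m, IsGLB {x, y} m := ⟨m, h⟩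
  unfold bmeet
  rw [dif_pos hex]
  exact hex.choose_spec.unique h

theorem bjoin_eq_of_isLUB {x y m : D} (h : IsLUB {x, y} m) : bjoin x y = m := by
  have hex : ∃ m, IsLUB {x, y} m := ⟨m, h⟩
  unfold bjoin
  rw [dif_pos hex]
  exact hex.choose_spec.unique h

theorem isGLB_pair_iff {x y m : D} :
    IsGLB {x, y} m ↔ m ≤ x ∧ m ≤ y ∧ ∀ z, z ≤ x → z ≤ y → z ≤ m := by
  constructor
  · intro h
    refine ⟨h.1 (by simp), h.1 (by simp), fun z hx hy => h.2 ?_⟩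
    rintro w (rfl | rfl) <;> assumption
  · rintro ⟨hx, hy, h⟩
    refine ⟨?_, fun z hz => h z (hz (by simp)) (hz (by simp))⟩
    rintro w (rfl | rfl) <;> assumption

theorem isLUB_pair_iff {x y m : D} :
    IsLUB {x, y} m ↔ x ≤ m ∧ y ≤ m ∧ ∀ z, x ≤ z → y ≤ z → m ≤ z := by
  constructor
  · intro h
    refine ⟨h.1 (by simp), h.1 (by simp), fun z hx hy => h.2 ?_⟩
    rintro w (rfl | rfl) <;> assumption
  · rintro ⟨hx, hy, h⟩
    refine ⟨?_, fun z hz => h z (hz (by simp)) (hz (by simp))⟩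
    rintro w (rfl | rfl) <;> assumption

theorem bmeet_of_le {x y : D} (h : x ≤ y) : bmeet x y = x :=
  bmeet_eq_of_isGLB (isGLB_pair_iff.2 ⟨le_rfl, h, fun _ hz _ => hz⟩)

theorem bmeet_of_ge {x y : D} (h : y ≤ x) : bmeet x y = y :=
  bmeet_eq_of_isGLB (isGLB_pair_iff.2 ⟨h, le_rfl, fun _ _ hz => hz⟩)

theorem bjoin_of_le {x y : D} (h : x ≤ y) : bjoin x y = y :=
  bjoin_eq_of_isLUB (isLUB_pair_iff.2 ⟨h, le_rfl, fun _ _ hz => hz⟩)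

theorem bjoin_of_ge {x y : D} (h : y ≤ x) : bjoin x y = x :=
  bjoin_eq_of_isLUB (isLUB_pair_iff.2 ⟨le_rfl, h, fun _ hz _ => hz⟩)

end Bounds

/-- A bistable biorder: a partial order (the extensional order) with an equivalence relation
`coh` (bistable coherence), each class of which is a distributive lattice whose inclusion into
the whole order preserves binary meets and joins. -/
class BistableBiorder (D : Type*) extends PartialOrder D where
  coh : D → D → Prop
  coh_equiv : Equivalence coh
  exists_glb : ∀ x y, coh x y → ∃ m, coh x m ∧ IsGLB {x, y} m
  exists_lub : ∀ x y, coh x y → ∃ m, coh x m ∧ IsLUB {x, y} m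
  distrib : ∀ x y z, coh x y → coh x z →
    bmeet x (bjoin y z) = bjoin (bmeet x y) (bmeet x z)

/-- Bistable coherence. -/
abbrev Coh {D : Type*} [BistableBiorder D] (x y : D) : Prop := BistableBiorder.coh x y

section Biorder

variable {D : Type*} [BistableBiorder D]

theorem Coh.refl (x : D) : Coh x x := BistableBiorder.coh_equiv.refl x
theorem Coh.symm {x y : D} (h : Coh x y) : Coh y x := BistableBiorder.coh_equiv.symm h
theorem Coh.trans {x y z : D} (h : Coh x y) (h' : Coh y z) : Coh x z :=
  BistableBiorder.coh_equiv.trans h h'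

theorem isGLB_bmeet {x y : D} (h : Coh x y) : IsGLB {x, y} (bmeet x y) := by
  obtain ⟨m, -, hm⟩ := BistableBiorder.exists_glb x y h
  rwa [bmeet_eq_of_isGLB hm]

theorem isLUB_bjoin {x y : D} (h : Coh x y) : IsLUB {x, y} (bjoin x y) := by
  obtain ⟨m, -, hm⟩ := BistableBiorder.exists_lub x y h
  rwa [bjoin_eq_of_isLUB hm]

theorem coh_bmeet {x y : D} (h : Coh x y) : Coh x (bmeet x y) := by
  obtain ⟨m, hc, hm⟩ := BistableBiorder.exists_glb x y h
  rwa [bmeet_eq_of_isGLB hm]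

theorem coh_bjoin {x y : D} (h : Coh x y) : Coh x (bjoin x y) := by
  obtain ⟨m, hc, hm⟩ := BistableBiorder.exists_lub x y h
  rwa [bjoin_eq_of_isLUB hm]

theorem bmeet_le_left {x y : D} (h : Coh x y) : bmeet x y ≤ x :=
  (isGLB_pair_iff.1 (isGLB_bmeet h)).1
theorem bmeet_le_right {x y : D} (h : Coh x y) : bmeet x y ≤ y :=
  (isGLB_pair_iff.1 (isGLB_bmeet h)).2.1
theorem le_bmeet {x y z : D} (h : Coh x y) (hx : z ≤ x) (hy : z ≤ y) : z ≤ bmeet x y :=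
  (isGLB_pair_iff.1 (isGLB_bmeet h)).2.2 z hx hy
theorem le_bjoin_left {x y : D} (h : Coh x y) : x ≤ bjoin x y :=
  (isLUB_pair_iff.1 (isLUB_bjoin h)).1
theorem le_bjoin_right {x y : D} (h : Coh x y) : y ≤ bjoin x y :=
  (isLUB_pair_iff.1 (isLUB_bjoin h)).2.1
theorem bjoin_le {x y z : D} (h : Coh x y) (hx : x ≤ z) (hy : y ≤ z) : bjoin x y ≤ z :=
  (isLUB_pair_iff.1 (isLUB_bjoin h)).2.2 z hx hy

theorem bmeet_mono {x y x' y' : D} (h : Coh x y) (h' : Coh x' y') (hx : x ≤ x') (hy : y ≤ y') :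
    bmeet x y ≤ bmeet x' y' :=
  le_bmeet h' ((bmeet_le_left h).trans hx) ((bmeet_le_right h).trans hy)

/-- The coherence class of `p`. -/
@[ext]
structure Cls (p : D) where
  val : D
  mem : Coh p val

theorem Cls.coh {p : D} (a b : Cls p) : Coh a.1 b.1 := Coh.trans (Coh.symm a.2) b.2

noncomputable instance (p : D) : DistribLattice (Cls p) :=
  letI : Lattice (Cls p) :=
    { PartialOrder.lift (Cls.val (p := p)) (fun _ _ h => Cls.ext h) with
      inf := fun a b => ⟨bmeet a.1 b.1, Coh.trans a.2 (coh_bmeet (Cls.coh a b))⟩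
      sup := fun a b => ⟨bjoin a.1 b.1, Coh.trans a.2 (coh_bjoin (Cls.coh a b))⟩
      inf_le_left := fun a b => bmeet_le_left (Cls.coh a b)
      inf_le_right := fun a b => bmeet_le_right (Cls.coh a b)
      le_inf := fun _ b c h h' => le_bmeet (Cls.coh b c) h h'
      le_sup_left := fun a b => le_bjoin_left (Cls.coh a b)
      le_sup_right := fun a b => le_bjoin_right (Cls.coh a b)
      sup_le := fun a b _ h h' => bjoin_le (Cls.coh a b) h h' }
  DistribLattice.ofInfSupLe fun a b c =>
    le_of_eq (Cls.ext
      (BistableBiorder.distrib a.1 b.1 c.1 (Cls.coh a b) (Cls.coh a c)))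

theorem Cls.val_inf {p : D} (a b : Cls p) : (a ⊓ b).1 = bmeet a.1 b.1 := rfl
theorem Cls.val_sup {p : D} (a b : Cls p) : (a ⊔ b).1 = bjoin a.1 b.1 := rfl

end Biorder

section LatticeFacts

variable {L : Type*} [DistribLattice L]

theorem lat_trans_le {a a' b b' c c' : L} (h1 : a ⊓ b' = a' ⊓ b) (h2 : a ⊔ b' = a' ⊔ b)
    (h3 : b ⊓ c' = b' ⊓ c) (h4 : b ⊔ c' = b' ⊔ c) : a ⊓ c' ≤ a' ⊓ c := by
  apply le_inf
  · have e : a ⊓ c' = (a ⊓ c') ⊓ (a' ⊔ b) := by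
      rw [← h2]; exact (inf_eq_left.2 (inf_le_left.trans le_sup_left)).symm
    rw [e, inf_sup_left]
    apply sup_le inf_le_right
    have : a ⊓ c' ⊓ b = a' ⊓ b ⊓ c := by
      rw [inf_assoc, inf_comm c' b, h3, ← inf_assoc, h1]
    rw [this]
    exact inf_le_left.trans inf_le_left
  · have e : a ⊓ c' = (a ⊓ c') ⊓ (b' ⊔ c) := by
      rw [← h4]; exact (inf_eq_left.2 (inf_le_right.trans le_sup_right)).symm
    rw [e, inf_sup_left]
    apply sup_le _ inf_le_right
    have : a ⊓ c' ⊓ b' = a' ⊓ (b' ⊓ c) := by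
      rw [inf_right_comm, h1, inf_assoc, h3]
    rw [this]
    exact inf_le_right.trans inf_le_right

theorem lat_trans {a a' b b' c c' : L} (h1 : a ⊓ b' = a' ⊓ b) (h2 : a ⊔ b' = a' ⊔ b)
    (h3 : b ⊓ c' = b' ⊓ c) (h4 : b ⊔ c' = b' ⊔ c) : a ⊓ c' = a' ⊓ c :=
  le_antisymm (lat_trans_le h1 h2 h3 h4) (lat_trans_le h1.symm h2.symm h3.symm h4.symm)

theorem lat_trans' {a a' b b' c c' : L} (h1 : a ⊓ b' = a' ⊓ b) (h2 : a ⊔ b' = a' ⊔ b)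
    (h3 : b ⊓ c' = b' ⊓ c) (h4 : b ⊔ c' = b' ⊔ c) : a ⊔ c' = a' ⊔ c :=
  lat_trans (L := Lᵒᵈ) h2 h1 h4 h3

/-- With `a, a' = f x, f y` and `b, b' = g x, g y`. -/
theorem lat_mix {a a' b b' : L} (h1 : a ⊓ b' = a' ⊓ b) :
    (a ⊔ a') ⊓ (b ⊔ b') = (a ⊓ b) ⊔ (a' ⊓ b') := by
  apply le_antisymm
  · have h5 : a ⊓ b' ≤ a ⊓ b := le_inf inf_le_left (h1.le.trans inf_le_right)
    rw [inf_sup_right, inf_sup_left, inf_sup_left, ← h1]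
    exact sup_le (sup_le le_sup_left (h5.trans le_sup_left))
      (sup_le (h5.trans le_sup_left) le_sup_right)
  · exact sup_le (inf_le_inf le_sup_left le_sup_left) (inf_le_inf le_sup_right le_sup_right)

theorem lat_mix' {a a' b b' : L} (h1 : a ⊔ b' = a' ⊔ b) :
    (a ⊓ a') ⊔ (b ⊓ b') = (a ⊔ b) ⊓ (a' ⊔ b') :=
  lat_mix (L := Lᵒᵈ) h1

theorem lat_self_inf {a a' b b' : L} (h1 : a ⊓ b' = a' ⊓ b) :
    a ⊓ (a' ⊓ b') = a' ⊓ (a ⊓ b) := by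
  apply le_antisymm
  · exact le_inf (inf_le_right.trans inf_le_left) (le_inf inf_le_left
      ((inf_le_inf_left a inf_le_right).trans (h1.le.trans inf_le_right)))
  · exact le_inf (inf_le_right.trans inf_le_left) (le_inf inf_le_left
      ((inf_le_inf_left a' inf_le_right).trans (h1.ge.trans inf_le_right)))

theorem lat_self_sup {a a' b b' : L} (h2 : a ⊔ b' = a' ⊔ b) :
    a ⊔ (a' ⊓ b') = a' ⊔ (a ⊓ b) := by
  rw [sup_inf_left, sup_inf_left, h2, sup_comm a a']

end LatticeFacts

/-- Bistable coherence of sets. -/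
def SetCoh {D : Type*} [BistableBiorder D] (X Y : Set D) : Prop :=
  ∀ x ∈ X, ∀ y ∈ Y, ∃ x' ∈ X, ∃ y' ∈ Y, x ≤ x' ∧ y ≤ y' ∧ Coh x' y'

/-- A bistable bicpo: a bistable biorder whose extensional order is a cpo, such that suprema of
coherent directed sets are coherent, and their meet is the supremum of the meets of coherent
pairs. -/
class BistableBicpo (D : Type*) extends BistableBiorder D where
  exists_sup : ∀ X : Set D, X.Nonempty → DirectedOn (· ≤ ·) X → ∃ s, IsLUB X s
  coh_sup : ∀ X Y : Set D, X.Nonempty → DirectedOn (· ≤ ·) X → Y.Nonempty →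
    DirectedOn (· ≤ ·) Y → SetCoh X Y → ∀ s t, IsLUB X s → IsLUB Y t →
      Coh s t ∧ IsLUB {z | ∃ x ∈ X, ∃ y ∈ Y, Coh x y ∧ z = bmeet x y} (bmeet s t)

/-- Pointed: least and greatest elements exist and are coherent. -/
class Pointed (D : Type*) [BistableBicpo D] where
  bot : D
  top : D
  bot_le : ∀ x : D, bot ≤ x
  le_top : ∀ x : D, x ≤ top
  coh_bot_top : Coh bot top

/-- Morphisms: (Scott-)continuous and bistable functions. -/
@[ext]
structure Hom (A B : Type*) [BistableBicpo A] [BistableBicpo B] where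
  toFun : A → B
  cont : ScottContinuous toFun
  map_coh : ∀ {x y}, Coh x y → Coh (toFun x) (toFun y)
  map_meet : ∀ {x y}, Coh x y → toFun (bmeet x y) = bmeet (toFun x) (toFun y)
  map_join : ∀ {x y}, Coh x y → toFun (bjoin x y) = bjoin (toFun x) (toFun y)

section HomSpace

variable {A B C E : Type*} [BistableBicpo A] [BistableBicpo B] [BistableBicpo C] [BistableBicpo E]

instance : CoeFun (Hom A B) (fun _ => A → B) := ⟨Hom.toFun⟩

theorem Hom.ext' {f g : Hom A B} (h : ∀ a, f a = g a) : f = g := Hom.ext (funext h)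

theorem Hom.mono (f : Hom A B) {x y : A} (h : x ≤ y) : f x ≤ f y := f.cont.monotone h

instance : PartialOrder (Hom A B) where
  le f g := ∀ x, f x ≤ g x
  le_refl f x := le_rfl
  le_trans f g h h1 h2 x := (h1 x).trans (h2 x)
  le_antisymm f g h1 h2 := Hom.ext' fun x => le_antisymm (h1 x) (h2 x)

/-- Bistable coherence of morphisms. -/
def HomCoh (f g : Hom A B) : Prop :=
  (∀ x, Coh (f x) (g x)) ∧ ∀ x y, Coh x y →
    bmeet (f x) (g y) = bmeet (f y) (g x) ∧ bjoin (f x) (g y) = bjoin (f y) (g x)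

theorem HomCoh.cross {f g : Hom A B} (h : HomCoh f g) {x y : A} (hxy : Coh x y) :
    Coh (f x) (g y) :=
  Coh.trans (f.map_coh hxy) (h.1 y)

/-- The four values `f x, f y, g x, g y` in one coherence class. -/
theorem HomCoh.lattice {f g : Hom A B} (h : HomCoh f g) {x y : A} (hxy : Coh x y) :
    ∃ a a' b b' : Cls (f x), a.1 = f x ∧ a'.1 = f y ∧ b.1 = g x ∧ b'.1 = g y ∧
      a ⊓ b' = a' ⊓ b ∧ a ⊔ b' = a' ⊔ b :=
  ⟨Cls.mk (f x) (Coh.refl _), Cls.mk (f y) (f.map_coh hxy), Cls.mk (g x) (h.1 x),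
    Cls.mk (g y) (h.cross hxy), rfl, rfl, rfl, rfl,
    Cls.ext (h.2 x y hxy).1, Cls.ext (h.2 x y hxy).2⟩

theorem HomCoh.equiv : Equivalence (HomCoh (A := A) (B := B)) where
  refl f := ⟨fun x => Coh.refl _, fun x y hxy => by
    obtain ⟨a, a', ha, ha', -⟩ : ∃ a a' : Cls (f x), a.1 = f x ∧ a'.1 = f y ∧ True :=
      ⟨Cls.mk (f x) (Coh.refl _), Cls.mk (f y) (f.map_coh hxy), rfl, rfl, trivial⟩
    rw [← ha, ← ha']
    exact ⟨congrArg Cls.val (inf_comm a a'), congrArg Cls.val (sup_comm a a')⟩⟩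
  symm {f g} h := ⟨fun x => Coh.symm (h.1 x), fun x y hxy => by
    obtain ⟨a, a', b, b', ha, ha', hb, hb', h1, h2⟩ := h.lattice hxy
    rw [← ha, ← ha', ← hb, ← hb']
    refine ⟨congrArg Cls.val (?_ : b ⊓ a' = b' ⊓ a),
      congrArg Cls.val (?_ : b ⊔ a' = b' ⊔ a)⟩
    · rw [inf_comm b, ← h1, inf_comm]
    · rw [sup_comm b, ← h2, sup_comm]⟩
  trans {f g k} h h' := ⟨fun x => Coh.trans (h.1 x) (h'.1 x), fun x y hxy => by
    obtain ⟨a, a', b, b', ha, ha', hb, hb', h1, h2⟩ := h.lattice hxy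
    have hc : Coh (f x) (k x) := Coh.trans (h.1 x) (h'.1 x)
    have hc' : Coh (f x) (k y) := Coh.trans hc (k.map_coh hxy)
    let c : Cls (f x) := Cls.mk (k x) hc
    let c' : Cls (f x) := Cls.mk (k y) hc'
    have h3 : b ⊓ c' = b' ⊓ c := Cls.ext (by
      rw [Cls.val_inf, Cls.val_inf, hb, hb']; exact (h'.2 x y hxy).1)
    have h4 : b ⊔ c' = b' ⊔ c := Cls.ext (by
      rw [Cls.val_sup, Cls.val_sup, hb, hb']; exact (h'.2 x y hxy).2)
    rw [← ha, ← ha']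
    exact ⟨congrArg Cls.val (lat_trans h1 h2 h3 h4),
      congrArg Cls.val (lat_trans' h1 h2 h3 h4)⟩⟩

/-- Pointwise meet of coherent morphisms. -/
noncomputable def Hom.inf (f g : Hom A B) (h : HomCoh f g) : Hom A B where
  toFun x := bmeet (f x) (g x)
  cont := by
    intro d hne hd a ha
    have hf := f.cont hne hd ha
    have hg := g.cont hne hd ha
    have hs : SetCoh (f '' d) (g '' d) := by
      rintro _ ⟨x, hx, rfl⟩ _ ⟨y, hy, rfl⟩
      obtain ⟨z, hz, hxz, hyz⟩ := hd x hx y hy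
      exact ⟨_, ⟨z, hz, rfl⟩, _, ⟨z, hz, rfl⟩, f.mono hxz, g.mono hyz, h.1 z⟩
    obtain ⟨-, hl⟩ := BistableBicpo.coh_sup _ _ (hne.image f)
      (hd.mono_comp (fun _ _ hxy => f.mono hxy)) (hne.image g)
      (hd.mono_comp (fun _ _ hxy => g.mono hxy)) hs _ _ hf hg
    constructor
    · rintro _ ⟨x, hx, rfl⟩
      exact bmeet_mono (h.1 x) (h.1 a) (f.mono (ha.1 hx)) (g.mono (ha.1 hx))
    · intro u hu
      apply hl.2
      rintro _ ⟨_, ⟨x, hx, rfl⟩, _, ⟨y, hy, rfl⟩, hc, rfl⟩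
      obtain ⟨z, hz, hxz, hyz⟩ := hd x hx y hy
      exact (bmeet_mono hc (h.1 z) (f.mono hxz) (g.mono hyz)).trans (hu ⟨z, hz, rfl⟩)
  map_coh {x y} hxy := Coh.trans (Coh.symm (coh_bmeet (h.1 x)))
    (Coh.trans (f.map_coh hxy) (coh_bmeet (h.1 y)))
  map_meet {x y} hxy := by
    rw [f.map_meet hxy, g.map_meet hxy]
    obtain ⟨a, a', b, b', ha, ha', hb, hb', h1, h2⟩ := h.lattice hxy
    rw [← ha, ← ha', ← hb, ← hb']
    exact congrArg Cls.val (inf_inf_inf_comm a a' b b')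
  map_join {x y} hxy := by
    rw [f.map_join hxy, g.map_join hxy]
    obtain ⟨a, a', b, b', ha, ha', hb, hb', h1, h2⟩ := h.lattice hxy
    rw [← ha, ← ha', ← hb, ← hb']
    exact congrArg Cls.val (lat_mix h1)

/-- Pointwise join of coherent morphisms. -/
noncomputable def Hom.sup (f g : Hom A B) (h : HomCoh f g) : Hom A B where
  toFun x := bjoin (f x) (g x)
  cont := by
    intro d hne hd a ha
    constructor
    · rintro _ ⟨x, hx, rfl⟩
      exact bjoin_le (h.1 x) ((f.mono (ha.1 hx)).trans (le_bjoin_left (h.1 a)))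
        ((g.mono (ha.1 hx)).trans (le_bjoin_right (h.1 a)))
    · intro u hu
      apply bjoin_le (h.1 a)
      · apply (f.cont hne hd ha).2
        rintro _ ⟨x, hx, rfl⟩
        exact (le_bjoin_left (h.1 x)).trans (hu ⟨x, hx, rfl⟩)
      · apply (g.cont hne hd ha).2
        rintro _ ⟨x, hx, rfl⟩
        exact (le_bjoin_right (h.1 x)).trans (hu ⟨x, hx, rfl⟩)
  map_coh {x y} hxy := Coh.trans (Coh.symm (coh_bjoin (h.1 x)))
    (Coh.trans (f.map_coh hxy) (coh_bjoin (h.1 y)))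
  map_meet {x y} hxy := by
    rw [f.map_meet hxy, g.map_meet hxy]
    obtain ⟨a, a', b, b', ha, ha', hb, hb', h1, h2⟩ := h.lattice hxy
    rw [← ha, ← ha', ← hb, ← hb']
    exact congrArg Cls.val (lat_mix' h2)
  map_join {x y} hxy := by
    rw [f.map_join hxy, g.map_join hxy]
    obtain ⟨a, a', b, b', ha, ha', hb, hb', h1, h2⟩ := h.lattice hxy
    rw [← ha, ← ha', ← hb, ← hb']
    exact congrArg Cls.val (sup_sup_sup_comm a a' b b')

theorem Hom.isGLB_inf (f g : Hom A B) (h : HomCoh f g) : IsGLB {f, g} (Hom.inf f g h) :=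
  isGLB_pair_iff.2 ⟨fun x => bmeet_le_left (h.1 x), fun x => bmeet_le_right (h.1 x),
    fun _ h1 h2 x => le_bmeet (h.1 x) (h1 x) (h2 x)⟩

theorem Hom.isLUB_sup (f g : Hom A B) (h : HomCoh f g) : IsLUB {f, g} (Hom.sup f g h) :=
  isLUB_pair_iff.2 ⟨fun x => le_bjoin_left (h.1 x), fun x => le_bjoin_right (h.1 x),
    fun _ h1 h2 x => bjoin_le (h.1 x) (h1 x) (h2 x)⟩

theorem Hom.bmeet_apply {f g : Hom A B} (h : HomCoh f g) (x : A) :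
    (bmeet f g) x = bmeet (f x) (g x) := by
  rw [bmeet_eq_of_isGLB (Hom.isGLB_inf f g h)]; rfl

theorem Hom.bjoin_apply {f g : Hom A B} (h : HomCoh f g) (x : A) :
    (bjoin f g) x = bjoin (f x) (g x) := by
  rw [bjoin_eq_of_isLUB (Hom.isLUB_sup f g h)]; rfl

theorem HomCoh.inf {f g : Hom A B} (h : HomCoh f g) : HomCoh f (Hom.inf f g h) :=
  ⟨fun x => coh_bmeet (h.1 x), fun x y hxy => by
    change bmeet (f x) (bmeet (f y) (g y)) = bmeet (f y) (bmeet (f x) (g x)) ∧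
      bjoin (f x) (bmeet (f y) (g y)) = bjoin (f y) (bmeet (f x) (g x))
    obtain ⟨a, a', b, b', ha, ha', hb, hb', h1, h2⟩ := h.lattice hxy
    rw [← ha, ← ha', ← hb, ← hb']
    exact ⟨congrArg Cls.val (lat_self_inf h1), congrArg Cls.val (lat_self_sup h2)⟩⟩

theorem HomCoh.sup {f g : Hom A B} (h : HomCoh f g) : HomCoh f (Hom.sup f g h) :=
  ⟨fun x => coh_bjoin (h.1 x), fun x y hxy => by
    change bmeet (f x) (bjoin (f y) (g y)) = bmeet (f y) (bjoin (f x) (g x)) ∧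
      bjoin (f x) (bjoin (f y) (g y)) = bjoin (f y) (bjoin (f x) (g x))
    obtain ⟨a, a', b, b', ha, ha', hb, hb', h1, h2⟩ := h.lattice hxy
    rw [← ha, ← ha', ← hb, ← hb']
    exact ⟨congrArg Cls.val (lat_self_sup (L := (Cls (f x))ᵒᵈ) h1),
      congrArg Cls.val (lat_self_inf (L := (Cls (f x))ᵒᵈ) h2)⟩⟩

noncomputable instance : BistableBiorder (Hom A B) where
  coh := HomCoh
  coh_equiv := HomCoh.equiv
  exists_glb f g h := ⟨Hom.inf f g h, h.inf, Hom.isGLB_inf f g h⟩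
  exists_lub f g h := ⟨Hom.sup f g h, h.sup, Hom.isLUB_sup f g h⟩
  distrib f g k h h' := by
    have hgk : HomCoh g k := HomCoh.equiv.trans (HomCoh.equiv.symm h) h'
    have h1 : HomCoh f (bjoin g k) := by
      rw [bjoin_eq_of_isLUB (Hom.isLUB_sup g k hgk)]
      exact HomCoh.equiv.trans h hgk.sup
    have h2 : HomCoh f (bmeet f g) := by
      rw [bmeet_eq_of_isGLB (Hom.isGLB_inf f g h)]; exact h.inf
    have h3 : HomCoh f (bmeet f k) := by
      rw [bmeet_eq_of_isGLB (Hom.isGLB_inf f k h')]; exact h'.inf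
    have h4 : HomCoh (bmeet f g) (bmeet f k) := HomCoh.equiv.trans (HomCoh.equiv.symm h2) h3
    apply Hom.ext'
    intro x
    rw [Hom.bmeet_apply h1, Hom.bjoin_apply hgk, Hom.bjoin_apply h4, Hom.bmeet_apply h,
      Hom.bmeet_apply h']
    exact BistableBiorder.distrib _ _ _ (h.1 x) (h'.1 x)

theorem Hom.directed_eval {F : Set (Hom A B)} (hd : DirectedOn (· ≤ ·) F) (a : A) :
    DirectedOn (· ≤ ·) ((fun f : Hom A B => f a) '' F) :=
  hd.mono_comp (fun _ _ h => h a)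

/-- Directed sets of morphisms have pointwise suprema. -/
theorem Hom.exists_pointwise_sup (F : Set (Hom A B)) (hne : F.Nonempty)
    (hd : DirectedOn (· ≤ ·) F) :
    ∃ s : Hom A B, ∀ a, IsLUB ((fun f : Hom A B => f a) '' F) (s a) := by
  choose s hs using fun a => BistableBicpo.exists_sup _ (hne.image (fun f : Hom A B => f a))
    (Hom.directed_eval hd a)
  have hle : ∀ f ∈ F, ∀ a, f a ≤ s a := fun f hf a => (hs a).1 ⟨f, hf, rfl⟩
  have hlub : ∀ a u, (∀ f ∈ F, f a ≤ u) → s a ≤ u := fun a u h => (hs a).2 (by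
    rintro _ ⟨f, hf, rfl⟩; exact h f hf)
  have hmono : ∀ a b, a ≤ b → s a ≤ s b := fun a b hab =>
    hlub a _ fun f hf => (f.mono hab).trans (hle f hf b)
  have hkey : ∀ a b, Coh a b → Coh (s a) (s b) ∧ IsLUB
      {z | ∃ x ∈ (fun f : Hom A B => f a) '' F, ∃ y ∈ (fun f : Hom A B => f b) '' F,
        Coh x y ∧ z = bmeet x y} (bmeet (s a) (s b)) := fun a b hab =>
    BistableBicpo.coh_sup _ _ (hne.image _) (Hom.directed_eval hd a) (hne.image _)
      (Hom.directed_eval hd b) (by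
        rintro _ ⟨f, hf, rfl⟩ _ ⟨g, hg, rfl⟩
        obtain ⟨k, hk, hfk, hgk⟩ := hd f hf g hg
        exact ⟨_, ⟨k, hk, rfl⟩, _, ⟨k, hk, rfl⟩, hfk a, hgk b, k.map_coh hab⟩) _ _ (hs a) (hs b)
  refine ⟨⟨s, ?_, fun {a b} hab => (hkey a b hab).1, ?_, ?_⟩, hs⟩
  · intro d hdne hdd a ha
    constructor
    · rintro _ ⟨x, hx, rfl⟩
      exact hmono _ _ (ha.1 hx)
    · intro u hu
      refine hlub a u fun f hf => (f.cont hdne hdd ha).2 ?_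
      rintro _ ⟨x, hx, rfl⟩
      exact (hle f hf x).trans (hu ⟨x, hx, rfl⟩)
  · intro a b hab
    obtain ⟨hc, hl⟩ := hkey a b hab
    apply le_antisymm
    · refine hlub _ _ fun f hf => ?_
      rw [f.map_meet hab]
      exact bmeet_mono (f.map_coh hab) hc (hle f hf a) (hle f hf b)
    · apply hl.2
      rintro _ ⟨_, ⟨f, hf, rfl⟩, _, ⟨g, hg, rfl⟩, hfg, rfl⟩
      obtain ⟨k, hk, hfk, hgk⟩ := hd f hf g hg
      refine (bmeet_mono hfg (k.map_coh hab) (hfk a) (hgk b)).trans ?_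
      rw [← k.map_meet hab]
      exact hle k hk _
  · intro a b hab
    have hc := (hkey a b hab).1
    apply le_antisymm
    · refine hlub _ _ fun f hf => ?_
      rw [f.map_join hab]
      exact bjoin_le (f.map_coh hab) ((hle f hf a).trans (le_bjoin_left hc))
        ((hle f hf b).trans (le_bjoin_right hc))
    · exact bjoin_le hc (hmono _ _ (le_bjoin_left hab)) (hmono _ _ (le_bjoin_right hab))

theorem Hom.isLUB_of_pointwise {F : Set (Hom A B)} {s : Hom A B}
    (h : ∀ a, IsLUB ((fun f : Hom A B => f a) '' F) (s a)) : IsLUB F s :=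
  ⟨fun f hf a => (h a).1 ⟨f, hf, rfl⟩, fun u hu a => (h a).2 (by
    rintro _ ⟨f, hf, rfl⟩; exact hu hf a)⟩

theorem Hom.pointwise_of_isLUB {F : Set (Hom A B)} {s : Hom A B} (hne : F.Nonempty)
    (hd : DirectedOn (· ≤ ·) F) (h : IsLUB F s) (a : A) :
    IsLUB ((fun f : Hom A B => f a) '' F) (s a) := by
  obtain ⟨t, ht⟩ := Hom.exists_pointwise_sup F hne hd
  rw [h.unique (Hom.isLUB_of_pointwise ht)]
  exact ht a

noncomputable instance : BistableBicpo (Hom A B) where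
  exists_sup F hne hd :=
    let ⟨s, hs⟩ := Hom.exists_pointwise_sup F hne hd
    ⟨s, Hom.isLUB_of_pointwise hs⟩
  coh_sup F G hF hdF hG hdG hFG s t hs ht := by
    have ps := Hom.pointwise_of_isLUB hF hdF hs
    have pt := Hom.pointwise_of_isLUB hG hdG ht
    have hkey := fun x y (hxy : Coh x y) =>
      BistableBicpo.coh_sup _ _ (hF.image (fun f : Hom A B => f x)) (Hom.directed_eval hdF x)
        (hG.image (fun f : Hom A B => f y)) (Hom.directed_eval hdG y) (by
          rintro _ ⟨f, hf, rfl⟩ _ ⟨g, hg, rfl⟩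
          obtain ⟨f', hf', g', hg', h1, h2, h3⟩ := hFG f hf g hg
          exact ⟨_, ⟨f', hf', rfl⟩, _, ⟨g', hg', rfl⟩, h1 x, h2 y, HomCoh.cross h3 hxy⟩)
        _ _ (ps x) (pt y)
    have hm : ∀ x y, Coh x y → bmeet (s x) (t y) ≤ bmeet (s y) (t x) := by
      intro x y hxy
      apply (hkey x y hxy).2.2
      rintro _ ⟨_, ⟨f, hf, rfl⟩, _, ⟨g, hg, rfl⟩, hfg, rfl⟩
      obtain ⟨f', hf', g', hg', h1, h2, h3⟩ := hFG f hf g hg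
      refine (bmeet_mono hfg (HomCoh.cross h3 hxy) (h1 x) (h2 y)).trans ?_
      rw [(h3.2 x y hxy).1]
      exact bmeet_mono (HomCoh.cross h3 hxy.symm) (hkey y x hxy.symm).1 (hs.1 hf' y) (ht.1 hg' x)
    have hj : ∀ x y, Coh x y → bjoin (s x) (t y) ≤ bjoin (s y) (t x) := by
      intro x y hxy
      have hb : ∀ f' ∈ F, ∀ g' ∈ G, HomCoh f' g' →
          bjoin (f' x) (g' y) ≤ bjoin (s y) (t x) := by
        intro f' hf' g' hg' h3
        rw [(h3.2 x y hxy).2]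
        have hc := (hkey y x hxy.symm).1
        exact bjoin_le (HomCoh.cross h3 hxy.symm) ((hs.1 hf' y).trans (le_bjoin_left hc))
          ((ht.1 hg' x).trans (le_bjoin_right hc))
      apply bjoin_le (hkey x y hxy).1
      · apply (ps x).2
        rintro _ ⟨f, hf, rfl⟩
        obtain ⟨g, hg⟩ := hG
        obtain ⟨f', hf', g', hg', h1, h2, h3⟩ := hFG f hf g hg
        exact (h1 x).trans ((le_bjoin_left (HomCoh.cross h3 hxy)).trans (hb f' hf' g' hg' h3))
      · apply (pt y).2
        rintro _ ⟨g, hg, rfl⟩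
        obtain ⟨f, hf⟩ := hF
        obtain ⟨f', hf', g', hg', h1, h2, h3⟩ := hFG f hf g hg
        exact (h2 y).trans ((le_bjoin_right (HomCoh.cross h3 hxy)).trans (hb f' hf' g' hg' h3))
    have hst : HomCoh s t := ⟨fun x => (hkey x x (Coh.refl x)).1, fun x y hxy =>
      ⟨le_antisymm (hm x y hxy) (hm y x hxy.symm), le_antisymm (hj x y hxy) (hj y x hxy.symm)⟩⟩
    refine ⟨hst, ?_, ?_⟩
    · rintro _ ⟨f, hf, g, hg, hfg, rfl⟩
      exact bmeet_mono hfg hst (hs.1 hf) (ht.1 hg)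
    · intro u hu x
      rw [Hom.bmeet_apply hst]
      apply (hkey x x (Coh.refl x)).2.2
      rintro _ ⟨_, ⟨f, hf, rfl⟩, _, ⟨g, hg, rfl⟩, hfg, rfl⟩
      obtain ⟨f', hf', g', hg', h1, h2, h3⟩ := hFG f hf g hg
      refine (bmeet_mono hfg (h3.1 x) (h1 x) (h2 x)).trans ?_
      rw [← Hom.bmeet_apply h3]
      exact hu ⟨f', hf', g', hg', h3, rfl⟩ x

/-! ### Products, the terminal object, and the combinators of a cartesian closed category -/

theorem prod_isGLB {x y m : A × B} (h1 : IsGLB {x.1, y.1} m.1) (h2 : IsGLB {x.2, y.2} m.2) :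
    IsGLB {x, y} m := by
  rw [isGLB_pair_iff] at *
  exact ⟨⟨h1.1, h2.1⟩, ⟨h1.2.1, h2.2.1⟩, fun z hx hy =>
    ⟨h1.2.2 _ hx.1 hy.1, h2.2.2 _ hx.2 hy.2⟩⟩

theorem prod_isLUB {x y m : A × B} (h1 : IsLUB {x.1, y.1} m.1) (h2 : IsLUB {x.2, y.2} m.2) :
    IsLUB {x, y} m := by
  rw [isLUB_pair_iff] at *
  exact ⟨⟨h1.1, h2.1⟩, ⟨h1.2.1, h2.2.1⟩, fun z hx hy =>
    ⟨h1.2.2 _ hx.1 hy.1, h2.2.2 _ hx.2 hy.2⟩⟩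

theorem prod_bmeet {x y : A × B} (h1 : Coh x.1 y.1) (h2 : Coh x.2 y.2) :
    bmeet x y = (bmeet x.1 y.1, bmeet x.2 y.2) :=
  bmeet_eq_of_isGLB (prod_isGLB (isGLB_bmeet h1) (isGLB_bmeet h2))

theorem prod_bjoin {x y : A × B} (h1 : Coh x.1 y.1) (h2 : Coh x.2 y.2) :
    bjoin x y = (bjoin x.1 y.1, bjoin x.2 y.2) :=
  bjoin_eq_of_isLUB (prod_isLUB (isLUB_bjoin h1) (isLUB_bjoin h2))

noncomputable instance : BistableBiorder (A × B) where
  toPartialOrder := inferInstance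
  coh x y := Coh x.1 y.1 ∧ Coh x.2 y.2
  coh_equiv := ⟨fun _ => ⟨Coh.refl _, Coh.refl _⟩, fun h => ⟨h.1.symm, h.2.symm⟩,
    fun h h' => ⟨h.1.trans h'.1, h.2.trans h'.2⟩⟩
  exists_glb x y h := ⟨(bmeet x.1 y.1, bmeet x.2 y.2), ⟨coh_bmeet h.1, coh_bmeet h.2⟩,
    prod_isGLB (isGLB_bmeet h.1) (isGLB_bmeet h.2)⟩
  exists_lub x y h := ⟨(bjoin x.1 y.1, bjoin x.2 y.2), ⟨coh_bjoin h.1, coh_bjoin h.2⟩,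
    prod_isLUB (isLUB_bjoin h.1) (isLUB_bjoin h.2)⟩
  distrib x y z h h' := by
    have c1 : Coh y.1 z.1 := h.1.symm.trans h'.1
    have c2 : Coh y.2 z.2 := h.2.symm.trans h'.2
    rw [prod_bjoin c1 c2, prod_bmeet h.1 h.2, prod_bmeet h'.1 h'.2,
      prod_bmeet (h.1.trans (coh_bjoin c1)) (h.2.trans (coh_bjoin c2)),
      prod_bjoin ((coh_bmeet h.1).symm.trans (coh_bmeet h'.1))
        ((coh_bmeet h.2).symm.trans (coh_bmeet h'.2))]
    exact Prod.ext (BistableBiorder.distrib _ _ _ h.1 h'.1)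
      (BistableBiorder.distrib _ _ _ h.2 h'.2)

theorem directed_fst {X : Set (A × B)} (hd : DirectedOn (· ≤ ·) X) :
    DirectedOn (· ≤ ·) (Prod.fst '' X) := hd.mono_comp (fun _ _ h => h.1)

theorem directed_snd {X : Set (A × B)} (hd : DirectedOn (· ≤ ·) X) :
    DirectedOn (· ≤ ·) (Prod.snd '' X) := hd.mono_comp (fun _ _ h => h.2)

noncomputable instance : BistableBicpo (A × B) where
  exists_sup X hne hd := by
    obtain ⟨s, hs⟩ := BistableBicpo.exists_sup _ (hne.image Prod.fst) (directed_fst hd)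
    obtain ⟨t, ht⟩ := BistableBicpo.exists_sup _ (hne.image Prod.snd) (directed_snd hd)
    exact ⟨(s, t), isLUB_prod.2 ⟨hs, ht⟩⟩
  coh_sup X Y hX hdX hY hdY hXY s t hs ht := by
    rw [isLUB_prod] at hs ht
    obtain ⟨c1, l1⟩ := BistableBicpo.coh_sup _ _ (hX.image Prod.fst) (directed_fst hdX)
      (hY.image Prod.fst) (directed_fst hdY) (by
        rintro _ ⟨x, hx, rfl⟩ _ ⟨y, hy, rfl⟩
        obtain ⟨x', hx', y', hy', h1, h2, h3⟩ := hXY x hx y hy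
        exact ⟨_, ⟨x', hx', rfl⟩, _, ⟨y', hy', rfl⟩, h1.1, h2.1, h3.1⟩) _ _ hs.1 ht.1
    obtain ⟨c2, l2⟩ := BistableBicpo.coh_sup _ _ (hX.image Prod.snd) (directed_snd hdX)
      (hY.image Prod.snd) (directed_snd hdY) (by
        rintro _ ⟨x, hx, rfl⟩ _ ⟨y, hy, rfl⟩
        obtain ⟨x', hx', y', hy', h1, h2, h3⟩ := hXY x hx y hy
        exact ⟨_, ⟨x', hx', rfl⟩, _, ⟨y', hy', rfl⟩, h1.2, h2.2, h3.2⟩) _ _ hs.2 ht.2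
    have hst : Coh s t := ⟨c1, c2⟩
    refine ⟨hst, ?_, ?_⟩
    · rintro _ ⟨x, hx, y, hy, hxy, rfl⟩
      exact bmeet_mono hxy hst ⟨hs.1.1 ⟨x, hx, rfl⟩, hs.2.1 ⟨x, hx, rfl⟩⟩
        ⟨ht.1.1 ⟨y, hy, rfl⟩, ht.2.1 ⟨y, hy, rfl⟩⟩
    · intro u hu
      rw [prod_bmeet c1 c2]
      constructor
      · apply l1.2
        rintro _ ⟨_, ⟨x, hx, rfl⟩, _, ⟨y, hy, rfl⟩, hxy, rfl⟩
        obtain ⟨x', hx', y', hy', h1, h2, h3⟩ := hXY x hx y hy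
        refine (bmeet_mono hxy h3.1 h1.1 h2.1).trans ?_
        have := (hu ⟨x', hx', y', hy', h3, rfl⟩).1
        rwa [prod_bmeet h3.1 h3.2] at this
      · apply l2.2
        rintro _ ⟨_, ⟨x, hx, rfl⟩, _, ⟨y, hy, rfl⟩, hxy, rfl⟩
        obtain ⟨x', hx', y', hy', h1, h2, h3⟩ := hXY x hx y hy
        refine (bmeet_mono hxy h3.2 h1.2 h2.2).trans ?_
        have := (hu ⟨x', hx', y', hy', h3, rfl⟩).2
        rwa [prod_bmeet h3.1 h3.2] at this

noncomputable instance : BistableBicpo PUnit where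
  toPartialOrder := inferInstance
  coh _ _ := True
  coh_equiv := ⟨fun _ => trivial, fun _ => trivial, fun _ _ => trivial⟩
  exists_glb _ _ _ := ⟨PUnit.unit, trivial, isGLB_pair_iff.2 ⟨le_rfl, le_rfl, fun _ _ _ => le_rfl⟩⟩
  exists_lub _ _ _ := ⟨PUnit.unit, trivial, isLUB_pair_iff.2 ⟨le_rfl, le_rfl, fun _ _ _ => le_rfl⟩⟩
  distrib _ _ _ _ _ := rfl
  exists_sup _ _ _ := ⟨PUnit.unit, fun _ _ => le_rfl, fun _ _ => le_rfl⟩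
  coh_sup _ _ _ _ _ _ _ _ _ _ _ := ⟨trivial, fun _ _ => le_rfl, fun _ _ => le_rfl⟩

noncomputable def Hom.const (b : B) : Hom A B where
  toFun _ := b
  cont d hne _ a _ := by
    rw [hne.image_const]; exact isLUB_singleton
  map_coh _ := Coh.refl b
  map_meet _ := (bmeet_of_le le_rfl).symm
  map_join _ := (bjoin_of_le le_rfl).symm

noncomputable def Hom.id : Hom A A where
  toFun x := x
  cont d _ _ a ha := by rwa [Set.image_id']
  map_coh h := h
  map_meet _ := rfl
  map_join _ := rfl

noncomputable def Hom.fst : Hom (A × B) A where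
  toFun := Prod.fst
  cont _ _ _ _ ha := (isLUB_prod.1 ha).1
  map_coh h := h.1
  map_meet h := congrArg Prod.fst (prod_bmeet h.1 h.2)
  map_join h := congrArg Prod.fst (prod_bjoin h.1 h.2)

noncomputable def Hom.snd : Hom (A × B) B where
  toFun := Prod.snd
  cont _ _ _ _ ha := (isLUB_prod.1 ha).2
  map_coh h := h.2
  map_meet h := congrArg Prod.snd (prod_bmeet h.1 h.2)
  map_join h := congrArg Prod.snd (prod_bjoin h.1 h.2)

noncomputable def Hom.comp (g : Hom B C) (f : Hom A B) : Hom A C where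
  toFun x := g (f x)
  cont d hne hd a ha := by
    have := g.cont (hne.image f) (hd.mono_comp (fun _ _ h => f.mono h)) (f.cont hne hd ha)
    rwa [Set.image_image] at this
  map_coh h := g.map_coh (f.map_coh h)
  map_meet h := by rw [f.map_meet h, g.map_meet (f.map_coh h)]
  map_join h := by rw [f.map_join h, g.map_join (f.map_coh h)]

noncomputable def Hom.pair (f : Hom A B) (g : Hom A C) : Hom A (B × C) where
  toFun x := (f x, g x)
  cont d hne hd a ha := isLUB_prod.2 ⟨by
      rw [Set.image_image]; exact f.cont hne hd ha, by
      rw [Set.image_image]; exact g.cont hne hd ha⟩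
  map_coh h := ⟨f.map_coh h, g.map_coh h⟩
  map_meet h := by
    rw [f.map_meet h, g.map_meet h]
    exact (prod_bmeet (x := (_, _)) (y := (_, _)) (f.map_coh h) (g.map_coh h)).symm
  map_join h := by
    rw [f.map_join h, g.map_join h]
    exact (prod_bjoin (x := (_, _)) (y := (_, _)) (f.map_coh h) (g.map_coh h)).symm

/-- `x ↦ f x (g x)`, i.e. pairing followed by evaluation. -/
noncomputable def Hom.app (f : Hom C (Hom A B)) (g : Hom C A) : Hom C B where
  toFun x := f x (g x)
  cont := by
    intro d hne hd a ha
    have hmono : ∀ x y, x ≤ y → f x (g x) ≤ f y (g y) := fun x y hxy =>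
      (f.mono hxy (g x)).trans ((f y).mono (g.mono hxy))
    constructor
    · rintro _ ⟨x, hx, rfl⟩
      exact hmono _ _ (ha.1 hx)
    · intro u hu
      apply (Hom.pointwise_of_isLUB (hne.image f) (hd.mono_comp (fun _ _ h => f.mono h))
        (f.cont hne hd ha) (g a)).2
      rintro _ ⟨_, ⟨x, hx, rfl⟩, rfl⟩
      apply ((f x).cont (hne.image g) (hd.mono_comp (fun _ _ h => g.mono h))
        (g.cont hne hd ha)).2
      rintro _ ⟨_, ⟨y, hy, rfl⟩, rfl⟩
      obtain ⟨z, hz, hxz, hyz⟩ := hd x hx y hy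
      exact ((f.mono hxz (g y)).trans ((f z).mono (g.mono hyz))).trans (hu ⟨z, hz, rfl⟩)
  map_coh {x y} h := HomCoh.cross (f.map_coh h) (g.map_coh h)
  map_meet {x y} h := by
    have hf : HomCoh (f x) (f y) := f.map_coh h
    have hg := g.map_coh h
    rw [f.map_meet h, g.map_meet h, Hom.bmeet_apply hf, (f x).map_meet hg, (f y).map_meet hg]
    obtain ⟨a, a', b, b', ha, ha', hb, hb', h1, h2⟩ := hf.lattice hg
    rw [← ha, ← ha', ← hb, ← hb']
    refine congrArg Cls.val (?_ : (a ⊓ a') ⊓ (b ⊓ b') = a ⊓ b')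
    rw [inf_inf_inf_comm]
    apply le_antisymm
    · exact le_inf (inf_le_left.trans inf_le_left) (inf_le_right.trans inf_le_right)
    · exact le_inf (le_inf inf_le_left (h1.le.trans inf_le_right))
        (le_inf (h1.le.trans inf_le_left) inf_le_right)
  map_join {x y} h := by
    have hf : HomCoh (f x) (f y) := f.map_coh h
    have hg := g.map_coh h
    rw [f.map_join h, g.map_join h, Hom.bjoin_apply hf, (f x).map_join hg, (f y).map_join hg]
    obtain ⟨a, a', b, b', ha, ha', hb, hb', h1, h2⟩ := hf.lattice hg
    rw [← ha, ← ha', ← hb, ← hb']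
    refine congrArg Cls.val (?_ : (a ⊔ a') ⊔ (b ⊔ b') = a ⊔ b')
    rw [sup_sup_sup_comm]
    apply le_antisymm
    · exact sup_le (sup_le le_sup_left (le_sup_right.trans h2.ge))
        (sup_le (le_sup_left.trans h2.ge) le_sup_right)
    · exact sup_le (le_sup_left.trans le_sup_left) (le_sup_right.trans le_sup_right)

/-- Partial application of a morphism on a product. -/
noncomputable def Hom.papp (f : Hom (C × A) B) (c : C) : Hom A B :=
  f.comp (Hom.pair (Hom.const c) Hom.id)

theorem Hom.papp_coh (f : Hom (C × A) B) {x y : C} (h : Coh x y) :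
    HomCoh (f.papp x) (f.papp y) :=
  ⟨fun a => f.map_coh (x := (x, a)) (y := (y, a)) ⟨h, Coh.refl a⟩, fun a b hab => by
    change bmeet (f (x, a)) (f (y, b)) = bmeet (f (x, b)) (f (y, a)) ∧
      bjoin (f (x, a)) (f (y, b)) = bjoin (f (x, b)) (f (y, a))
    have h1 : Coh (x, a) (y, b) := ⟨h, hab⟩
    have h2 : Coh (x, b) (y, a) := ⟨h, hab.symm⟩
    rw [← f.map_meet h1, ← f.map_meet h2, ← f.map_join h1, ← f.map_join h2]
    rw [prod_bmeet h1.1 h1.2, prod_bmeet h2.1 h2.2, prod_bjoin h1.1 h1.2, prod_bjoin h2.1 h2.2]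
    change f (bmeet x y, bmeet a b) = f (bmeet x y, bmeet b a) ∧
      f (bjoin x y, bjoin a b) = f (bjoin x y, bjoin b a)
    have e1 : bmeet a b = bmeet b a :=
      bmeet_eq_of_isGLB (Set.pair_comm b a ▸ isGLB_bmeet hab.symm)
    have e2 : bjoin a b = bjoin b a :=
      bjoin_eq_of_isLUB (Set.pair_comm b a ▸ isLUB_bjoin hab.symm)
    rw [e1, e2]
    exact ⟨rfl, rfl⟩⟩

noncomputable def Hom.curry (f : Hom (C × A) B) : Hom C (Hom A B) where
  toFun c := f.papp c
  cont := by
    intro d hne hd c hc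
    apply Hom.isLUB_of_pointwise
    intro a
    rw [Set.image_image]
    exact (f.comp (Hom.pair Hom.id (Hom.const a))).cont hne hd hc
  map_coh h := f.papp_coh h
  map_meet {x y} h := Hom.ext' fun a => by
    rw [Hom.bmeet_apply (f.papp_coh h)]
    change f (bmeet x y, a) = bmeet (f (x, a)) (f (y, a))
    have h1 : Coh (x, a) (y, a) := ⟨h, Coh.refl a⟩
    rw [← f.map_meet h1, prod_bmeet h1.1 h1.2]
    change _ = f (bmeet x y, bmeet a a)
    rw [bmeet_of_le le_rfl]
  map_join {x y} h := Hom.ext' fun a => by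
    rw [Hom.bjoin_apply (f.papp_coh h)]
    change f (bjoin x y, a) = bjoin (f (x, a)) (f (y, a))
    have h1 : Coh (x, a) (y, a) := ⟨h, Coh.refl a⟩
    rw [← f.map_join h1, prod_bjoin h1.1 h1.2]
    change _ = f (bjoin x y, bjoin a a)
    rw [bjoin_of_le le_rfl]

/-- A monotone, coherence-preserving function is a morphism if coherent elements of its domain
are comparable and directed suprema in its domain are attained. -/
def Hom.ofChain (f : A → B) (hmono : ∀ x y, x ≤ y → f x ≤ f y)
    (hcoh : ∀ x y, Coh x y → Coh (f x) (f y)) (htot : ∀ x y : A, Coh x y → x ≤ y ∨ y ≤ x)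
    (hatt : ∀ (d : Set A) (a : A), d.Nonempty → DirectedOn (· ≤ ·) d → IsLUB d a → a ∈ d) :
    Hom A B where
  toFun := f
  cont d hne hd a ha := ⟨by
      rintro _ ⟨x, hx, rfl⟩
      exact hmono _ _ (ha.1 hx), fun u hu => hu ⟨a, hatt d a hne hd ha, rfl⟩⟩
  map_coh {x y} h := hcoh x y h
  map_meet {x y} h := by
    rcases htot x y h with h | h
    · rw [bmeet_of_le h, bmeet_of_le (hmono _ _ h)]
    · rw [bmeet_of_ge h, bmeet_of_ge (hmono _ _ h)]
  map_join {x y} h := by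
    rcases htot x y h with h | h
    · rw [bjoin_of_le h, bjoin_of_le (hmono _ _ h)]
    · rw [bjoin_of_ge h, bjoin_of_ge (hmono _ _ h)]

instance [Pointed A] [Pointed B] : Pointed (A × B) where
  bot := (Pointed.bot, Pointed.bot)
  top := (Pointed.top, Pointed.top)
  bot_le _ := ⟨Pointed.bot_le _, Pointed.bot_le _⟩
  le_top _ := ⟨Pointed.le_top _, Pointed.le_top _⟩
  coh_bot_top := ⟨Pointed.coh_bot_top, Pointed.coh_bot_top⟩

noncomputable instance [Pointed B] : Pointed (Hom A B) where
  bot := Hom.const Pointed.bot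
  top := Hom.const Pointed.top
  bot_le _ _ := Pointed.bot_le _
  le_top _ _ := Pointed.le_top _
  coh_bot_top := ⟨fun _ => Pointed.coh_bot_top, fun _ _ _ => ⟨rfl, rfl⟩⟩

instance : Pointed PUnit where
  bot := PUnit.unit
  top := PUnit.unit
  bot_le _ := le_rfl
  le_top _ := le_rfl
  coh_bot_top := trivial

/-- The approximants of the fixpoint operator: `fixApprox n f = f (f (... (f ⊥)))`. -/
noncomputable def fixApprox (A : Type*) [BistableBicpo A] [Pointed A] : ℕ → Hom (Hom A A) A
  | 0 => Hom.const Pointed.bot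
  | n + 1 => Hom.app Hom.id (fixApprox A n)

theorem exists_fix (A : Type*) [BistableBicpo A] [Pointed A] :
    ∃ y : Hom (Hom A A) A, IsLUB (Set.range (fixApprox A)) y := by
  have hm : Monotone (fixApprox A) := monotone_nat_of_le_succ fun n => by
    induction n with
    | zero => exact fun f => Pointed.bot_le _
    | succ n ih => exact fun f => f.mono (ih f)
  exact BistableBicpo.exists_sup _ (Set.range_nonempty _)
    (directedOn_range.2 (directed_of_isDirected_le hm))

/-- The fixpoint operator, the supremum of its approximants. -/
noncomputable def fixHom (A : Type*) [BistableBicpo A] [Pointed A] : Hom (Hom A A) A :=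
  (exists_fix A).choose

end HomSpace

/-! ### Bilifting of sets -/

/-- The bilifting of the set `X` (with trivial orderings): a new least and a new greatest
element are added, and these are made coherent. -/
inductive Flat (X : Type*)
  | bot : Flat X
  | val (x : X) : Flat X
  | top : Flat X

namespace Flat

variable {X : Type*}

instance : PartialOrder (Flat X) where
  le x y := x = bot ∨ y = top ∨ x = y
  le_refl x := Or.inr (Or.inr rfl)
  le_trans x y z h h' := by
    rcases h with rfl | rfl | rfl
    · exact Or.inl rfl
    · rcases h' with h | rfl | rfl
      · exact absurd h (by simp)
      · exact Or.inr (Or.inl rfl)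
      · exact Or.inr (Or.inl rfl)
    · exact h'
  le_antisymm x y h h' := by
    rcases h with rfl | rfl | rfl
    · rcases h' with rfl | h | rfl
      · rfl
      · exact absurd h (by simp)
      · rfl
    · rcases h' with h | rfl | rfl
      · exact absurd h (by simp)
      · rfl
      · rfl
    · rfl

theorem le_def {x y : Flat X} : x ≤ y ↔ x = bot ∨ y = top ∨ x = y := Iff.rfl

/-- Coherence in the bilifting: the two new elements are coherent with each other. -/
def FCoh (x y : Flat X) : Prop := x = y ∨ ((x = bot ∨ x = top) ∧ (y = bot ∨ y = top))

theorem FCoh.total {x y : Flat X} (h : FCoh x y) : x ≤ y ∨ y ≤ x := by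
  rcases h with rfl | ⟨rfl | rfl, rfl | rfl⟩ <;> simp [le_def]

theorem FCoh.equiv : Equivalence (FCoh (X := X)) where
  refl _ := Or.inl rfl
  symm h := h.elim (fun h => Or.inl h.symm) (fun h => Or.inr ⟨h.2, h.1⟩)
  trans h h' := by
    rcases h with rfl | h
    · exact h'
    · rcases h' with rfl | h'
      · exact Or.inr h
      · exact Or.inr ⟨h.1, h'.2⟩

instance : BistableBiorder (Flat X) where
  coh := FCoh
  coh_equiv := FCoh.equiv
  exists_glb x y h := by
    rcases h.total with hl | hl
    · exact ⟨x, FCoh.equiv.refl x, isGLB_pair_iff.2 ⟨le_rfl, hl, fun _ hz _ => hz⟩⟩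
    · exact ⟨y, h, isGLB_pair_iff.2 ⟨hl, le_rfl, fun _ _ hz => hz⟩⟩
  exists_lub x y h := by
    rcases h.total with hl | hl
    · exact ⟨y, h, isLUB_pair_iff.2 ⟨hl, le_rfl, fun _ _ hz => hz⟩⟩
    · exact ⟨x, FCoh.equiv.refl x, isLUB_pair_iff.2 ⟨le_rfl, hl, fun _ hz _ => hz⟩⟩
  distrib x y z h h' := by
    have mono : ∀ {y z : Flat X}, FCoh x y → FCoh x z → y ≤ z → bmeet x y ≤ bmeet x z := by
      intro y z h h' hyz
      rcases h.total with h1 | h1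
      · rw [bmeet_of_le h1, bmeet_of_le (h1.trans hyz)]
      · rw [bmeet_of_ge h1]
        rcases h'.total with h2 | h2
        · rwa [bmeet_of_le h2]
        · rwa [bmeet_of_ge h2]
    rcases (FCoh.equiv.trans (FCoh.equiv.symm h) h').total with h3 | h3
    · rw [bjoin_of_le h3, bjoin_of_le (mono h h' h3)]
    · rw [bjoin_of_ge h3, bjoin_of_ge (mono h' h h3)]

theorem mem_of_isLUB (d : Set (Flat X)) (a : Flat X) (hne : d.Nonempty)
    (hd : DirectedOn (· ≤ ·) d) (ha : IsLUB d a) : a ∈ d := by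
  have key : ∃ m ∈ d, ∀ x ∈ d, x ≤ m := by
    by_cases ht : top ∈ d
    · exact ⟨top, ht, fun x _ => Or.inr (Or.inl rfl)⟩
    by_cases hv : ∃ v, val v ∈ d
    · obtain ⟨v, hv⟩ := hv
      refine ⟨val v, hv, fun x hx => ?_⟩
      obtain ⟨z, hz, h1, h2⟩ := hd _ hv x hx
      rcases h1 with h1 | rfl | rfl
      · exact absurd h1 (by simp)
      · exact absurd hz ht
      · exact h2
    · obtain ⟨x, hx⟩ := hne
      refine ⟨x, hx, fun y hy => Or.inl ?_⟩
      cases y with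
      | bot => rfl
      | val v => exact absurd ⟨v, hy⟩ hv
      | top => exact absurd hy ht
  obtain ⟨m, hm, hle⟩ := key
  rwa [ha.unique ⟨hle, fun u hu => hu hm⟩]

instance : BistableBicpo (Flat X) where
  exists_sup d hne hd := by
    by_cases ht : top ∈ d
    · exact ⟨top, fun x _ => Or.inr (Or.inl rfl), fun u hu => hu ht⟩
    by_cases hv : ∃ v, val v ∈ d
    · obtain ⟨v, hv⟩ := hv
      refine ⟨val v, fun x hx => ?_, fun u hu => hu hv⟩
      obtain ⟨z, hz, h1, h2⟩ := hd _ hv x hx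
      rcases h1 with h1 | rfl | rfl
      · exact absurd h1 (by simp)
      · exact absurd hz ht
      · exact h2
    · refine ⟨bot, fun y hy => ?_, fun u _ => Or.inl rfl⟩
      cases y with
      | bot => exact le_rfl
      | val v => exact absurd ⟨v, hy⟩ hv
      | top => exact absurd hy ht
  coh_sup d e hd hdd he hde hc s t hs ht := by
    have hsd := mem_of_isLUB d s hd hdd hs
    have hte := mem_of_isLUB e t he hde ht
    obtain ⟨s', hs', t', ht', h1, h2, h3⟩ := hc s hsd t hte
    rw [le_antisymm (hs.1 hs') h1, le_antisymm (ht.1 ht') h2] at h3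
    refine ⟨h3, ?_, fun u hu => hu ⟨s, hsd, t, hte, h3, rfl⟩⟩
    rintro _ ⟨x, hx, y, hy, hxy, rfl⟩
    exact bmeet_mono hxy h3 (hs.1 hx) (ht.1 hy)

instance : Pointed (Flat X) where
  bot := bot
  top := top
  bot_le _ := Or.inl rfl
  le_top _ := Or.inr (Or.inl rfl)
  coh_bot_top := Or.inr ⟨Or.inl rfl, Or.inr rfl⟩

variable {B : Type*} [BistableBicpo B] [Pointed B]

/-- The function underlying the bistrict extension of `f`. -/
def extFun (f : X → B) : Flat X → B
  | bot => Pointed.bot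
  | val x => f x
  | top => Pointed.top

/-- The bistrict extension of a function from `X` to a pointed bistable bicpo. -/
def ext (f : X → B) : Hom (Flat X) B :=
  Hom.ofChain (extFun f)
    (by
      rintro x y (rfl | rfl | rfl)
      · exact Pointed.bot_le _
      · exact Pointed.le_top _
      · exact le_rfl)
    (by
      rintro x y (rfl | ⟨rfl | rfl, rfl | rfl⟩)
      · exact Coh.refl _
      · exact Coh.refl _
      · exact Pointed.coh_bot_top
      · exact Coh.symm Pointed.coh_bot_top
      · exact Coh.refl _)
    (fun _ _ h => FCoh.total h) mem_of_isLUB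

end Flat

/-! ## Types of SPCF and their interpretation -/

/-- Types of SPCF. -/
inductive Ty
  | sig
  | nat
  | arr (S T : Ty)
  | prod (S T : Ty)

/-- `Ty.pow n` is the power `Σ^(n+1)`, with `Σ^1 = Σ` and `Σ^(n+2) = Σ × Σ^(n+1)`.
There is no unit type, so only positive powers exist. -/
def Ty.pow : ℕ → Ty
  | 0 => Ty.sig
  | n + 1 => Ty.prod Ty.sig (Ty.pow n)

/-- The ground types. -/
def Ty.IsGround (T : Ty) : Prop := T = Ty.sig ∨ T = Ty.nat

/-- Bundled pointed bistable bicpos. -/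
structure Obj where
  carrier : Type
  [bicpo : BistableBicpo carrier]
  [pointed : Pointed carrier]

attribute [instance] Obj.bicpo Obj.pointed

/-- Interpretation of types: `Σ = {⊥, ⊤}` is the bilifting of the empty set and `nat` that of
the natural numbers. -/
noncomputable def Ty.obj : Ty → Obj
  | Ty.sig => ⟨Flat Empty⟩
  | Ty.nat => ⟨Flat ℕ⟩
  | Ty.arr S T => ⟨Hom (Ty.obj S).carrier (Ty.obj T).carrier⟩
  | Ty.prod S T => ⟨(Ty.obj S).carrier × (Ty.obj T).carrier⟩

/-- The bistable bicpo interpreting a type. -/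
abbrev Ty.Den (T : Ty) : Type := T.obj.carrier

/-- Interpretation of contexts, as products. -/
noncomputable def ctxObj : List Ty → Obj
  | [] => ⟨PUnit⟩
  | T :: Γ => ⟨(ctxObj Γ).carrier × T.Den⟩

/-- The bistable bicpo interpreting a context. -/
abbrev CtxDen (Γ : List Ty) : Type := (ctxObj Γ).carrier

/-! ### The interpretation of `catch` -/

section Catch

/-- The projections `Σ^(n+1) ⇒ Σ`, numbered from `0`. -/
noncomputable def projHom : (n : ℕ) → Fin (n + 1) → Hom (Ty.pow n).Den Ty.sig.Den
  | 0, _ => (Hom.id : Hom Ty.sig.Den Ty.sig.Den)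
  | n + 1, i =>
    Fin.cases (motive := fun _ => Hom (Ty.sig.Den × (Ty.pow n).Den) Ty.sig.Den)
      Hom.fst (fun j => (projHom n j).comp Hom.snd) i

theorem sig_cases (x : Ty.sig.Den) : x = Pointed.bot ∨ x = Pointed.top := by
  cases (show Flat Empty from x) with
  | bot => exact Or.inl rfl
  | val v => exact v.elim
  | top => exact Or.inr rfl

theorem sig_bot_ne_top : (Pointed.bot : Ty.sig.Den) ≠ Pointed.top := by
  intro h
  exact absurd (show (Flat.bot : Flat Empty) = Flat.top from h) (by simp)

theorem sig_top_not_le : ¬ (Pointed.top : Ty.sig.Den) ≤ Pointed.bot := fun h =>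
  sig_bot_ne_top (le_antisymm (Pointed.bot_le _) h)

theorem sig_coh (x y : Ty.sig.Den) : Coh x y := by
  have hb : Coh (Pointed.bot : Ty.sig.Den) Pointed.top := Pointed.coh_bot_top
  rcases sig_cases x with rfl | rfl <;> rcases sig_cases y with rfl | rfl
  exacts [Coh.refl _, hb, hb.symm, Coh.refl _]

theorem pow_coh (n : ℕ) : ∀ x y : (Ty.pow n).Den, Coh x y := by
  induction n with
  | zero => exact sig_coh
  | succ n ih => exact fun x y => ⟨sig_coh x.1 y.1, ih x.2 y.2⟩

theorem projHom_bot (n : ℕ) : ∀ i, projHom n i Pointed.bot = Pointed.bot := by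
  induction n with
  | zero => exact fun _ => rfl
  | succ n ih => exact fun i => Fin.cases rfl (fun j => ih j) i

theorem projHom_top (n : ℕ) : ∀ i, projHom n i Pointed.top = Pointed.top := by
  induction n with
  | zero => exact fun _ => rfl
  | succ n ih => exact fun i => Fin.cases rfl (fun j => ih j) i

theorem projHom_le (n : ℕ) : ∀ i j, projHom n i ≤ projHom n j → i = j := by
  induction n with
  | zero => exact fun i j _ => Fin.ext (by omega)
  | succ n ih =>
    intro i j
    refine Fin.cases ?_ (fun i => ?_) i <;> refine Fin.cases ?_ (fun j => ?_) j
    · exact fun _ => rfl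
    · intro h
      have h1 : (Pointed.top : Ty.sig.Den) ≤ projHom n j Pointed.bot :=
        h (Pointed.top, Pointed.bot)
      rw [projHom_bot] at h1
      exact absurd h1 sig_top_not_le
    · intro h
      have h1 : projHom n i Pointed.top ≤ (Pointed.bot : Ty.sig.Den) :=
        h (Pointed.bot, Pointed.top)
      rw [projHom_top] at h1
      exact absurd h1 sig_top_not_le
    · intro h
      exact congrArg Fin.succ (ih i j fun x => h (Pointed.bot, x))

/-- First-order sequentiality: every morphism `Σ^(n+1) ⇒ Σ` is constant or a projection. -/
theorem pow_cases (n : ℕ) : ∀ f : Hom (Ty.pow n).Den Ty.sig.Den,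
    f = Pointed.bot ∨ f = Pointed.top ∨ ∃ i, f = projHom n i := by
  induction n with
  | zero =>
    intro f
    rcases sig_cases (f Pointed.bot) with h0 | h0
    · rcases sig_cases (f Pointed.top) with h1 | h1
      · left
        apply le_antisymm _ (Pointed.bot_le _)
        intro x
        exact (f.mono (Pointed.le_top x)).trans h1.le
      · right; right
        refine ⟨0, Hom.ext' fun x => ?_⟩
        rcases sig_cases x with rfl | rfl
        · exact h0
        · exact h1
    · right; left
      apply le_antisymm (Pointed.le_top _)
      intro x
      exact h0.ge.trans (f.mono (Pointed.bot_le x))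
  | succ n ih =>
    intro f
    let f' : Hom (Ty.sig.Den × (Ty.pow n).Den) Ty.sig.Den := f
    change f' = Pointed.bot ∨ f' = Pointed.top ∨ ∃ i, f' = projHom (n + 1) i
    generalize f' = f
    rcases sig_cases (f Pointed.bot) with h0 | h0
    swap
    · right; left
      apply le_antisymm (Pointed.le_top _)
      intro x
      exact h0.ge.trans (f.mono (Pointed.bot_le x))
    rcases sig_cases (f Pointed.top) with h1 | h1
    · left
      apply le_antisymm _ (Pointed.bot_le _)
      intro x
      exact (f.mono (Pointed.le_top x)).trans h1.le
    right; right
    rcases sig_cases (f (Pointed.top, Pointed.bot)) with h2 | h2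
    · -- then `f` depends only on the second component
      let g : Hom (Ty.pow n).Den Ty.sig.Den :=
        f.comp (Hom.pair (Hom.const Pointed.bot) Hom.id)
      have hf : ∀ a b, f (a, b) = g b := by
        intro a b
        rcases sig_cases a with rfl | rfl
        · rfl
        have hc : Coh ((Pointed.top, Pointed.bot) : Ty.sig.Den × (Ty.pow n).Den)
          (Pointed.bot, b) := ⟨sig_coh _ _, pow_coh n _ _⟩
        have e : bjoin ((Pointed.top, Pointed.bot) : Ty.sig.Den × (Ty.pow n).Den)
            (Pointed.bot, b) = (Pointed.top, b) := by
          rw [prod_bjoin hc.1 hc.2]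
          exact Prod.ext (bjoin_of_ge (Pointed.bot_le _)) (bjoin_of_le (Pointed.bot_le _))
        rw [← e, f.map_join hc, h2]
        exact bjoin_of_le (Pointed.bot_le _)
      rcases ih g with hg | hg | ⟨i, hg⟩
      · exfalso
        apply sig_bot_ne_top
        rw [← h1]
        exact (congrFun (congrArg Hom.toFun hg) Pointed.top).symm.trans (hf _ _).symm
      · exfalso
        apply sig_bot_ne_top
        rw [← h0]
        exact (hf _ _).trans (congrFun (congrArg Hom.toFun hg) Pointed.bot)
      · refine ⟨i.succ, Hom.ext' fun x => ?_⟩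
        exact (hf x.1 x.2).trans (congrFun (congrArg Hom.toFun hg) x.2)
    · refine ⟨0, Hom.ext' fun x => ?_⟩
      change f x = x.1
      rcases sig_cases x.1 with hx | hx
      · have hc : Coh ((Pointed.top, Pointed.bot) : Ty.sig.Den × (Ty.pow n).Den) x :=
          ⟨sig_coh _ _, pow_coh n _ _⟩
        have e : bmeet ((Pointed.top, Pointed.bot) : Ty.sig.Den × (Ty.pow n).Den) x =
            Pointed.bot := by
          rw [prod_bmeet hc.1 hc.2, hx]
          exact Prod.ext (bmeet_of_ge (Pointed.bot_le _)) (bmeet_of_le (Pointed.bot_le _))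
        have := f.map_meet hc
        rw [e, h0, h2, bmeet_of_ge (Pointed.le_top _)] at this
        rw [hx, ← this]
      · rw [hx]
        apply le_antisymm (Pointed.le_top _)
        rw [← h2]
        exact f.mono ⟨hx.ge, Pointed.bot_le _⟩

theorem projHom_ne_bot (n : ℕ) (i) : projHom n i ≠ Pointed.bot := fun h =>
  sig_bot_ne_top ((congrFun (congrArg Hom.toFun h) Pointed.top).symm.trans (projHom_top n i))

theorem projHom_ne_top (n : ℕ) (i) : projHom n i ≠ Pointed.top := fun h =>
  sig_bot_ne_top ((projHom_bot n i).symm.trans (congrFun (congrArg Hom.toFun h) Pointed.bot))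

theorem powHom_bot_ne_top (n : ℕ) :
    (Pointed.bot : Hom (Ty.pow n).Den Ty.sig.Den) ≠ Pointed.top := fun h =>
  sig_bot_ne_top (congrFun (congrArg Hom.toFun h) Pointed.bot)

theorem projHom_not_coh_top (n : ℕ) (i) : ¬ HomCoh (projHom n i) Pointed.top := by
  intro h
  have h1 := (h.2 Pointed.top Pointed.bot (pow_coh n _ _)).1
  rw [projHom_bot, projHom_top] at h1
  change bmeet (Pointed.top : Ty.sig.Den) Pointed.top = bmeet Pointed.bot Pointed.top at h1
  rw [bmeet_of_le le_rfl, bmeet_of_le (Pointed.bot_le _)] at h1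
  exact sig_bot_ne_top h1.symm

theorem projHom_not_coh_bot (n : ℕ) (i) : ¬ HomCoh (projHom n i) Pointed.bot := fun h =>
  projHom_not_coh_top n i (HomCoh.equiv.trans h
    (Pointed.coh_bot_top (D := Hom (Ty.pow n).Den Ty.sig.Den)))

theorem projHom_coh (n : ℕ) : ∀ i j, HomCoh (projHom n i) (projHom n j) → i = j := by
  induction n with
  | zero => exact fun i j _ => Fin.ext (by omega)
  | succ n ih =>
    have aux : ∀ j : Fin (n + 1), ¬ HomCoh (projHom (n + 1) 0) (projHom (n + 1) j.succ) := by
      intro j h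
      have h1 : bmeet (Pointed.top : Ty.sig.Den) (projHom n j Pointed.top) =
          bmeet Pointed.bot (projHom n j Pointed.bot) :=
        (h.2 (Pointed.top, Pointed.bot) (Pointed.bot, Pointed.top) (pow_coh (n + 1) _ _)).1
      rw [projHom_bot, projHom_top, bmeet_of_le le_rfl, bmeet_of_le le_rfl] at h1
      exact sig_bot_ne_top h1.symm
    intro i j
    refine Fin.cases ?_ (fun i => ?_) i <;> refine Fin.cases ?_ (fun j => ?_) j
    · exact fun _ => rfl
    · exact fun h => absurd h (aux j)
    · exact fun h => absurd (HomCoh.equiv.symm h) (aux i)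
    · intro h
      refine congrArg Fin.succ (ih i j ⟨fun x => sig_coh _ _, fun x y _ => ?_⟩)
      exact h.2 (Pointed.bot, x) (Pointed.bot, y) (pow_coh (n + 1) _ _)

open Classical in
/-- The function underlying `catch`: the `i`-th projection goes to the value `i`, the constant
functions `⊤` and `⊥` to `⊤` and `⊥`. -/
noncomputable def catchFun (n : ℕ) (f : Hom (Ty.pow n).Den Ty.sig.Den) : Flat ℕ :=
  if h : ∃ i, f = projHom n i then Flat.val (h.choose : Fin (n + 1)).val
  else if f = Pointed.top then Flat.top
  else Flat.bot

theorem catchFun_proj (n : ℕ) (i : Fin (n + 1)) : catchFun n (projHom n i) = Flat.val i.val := by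
  have h : ∃ j, projHom n i = projHom n j := ⟨i, rfl⟩
  unfold catchFun
  rw [dif_pos h, ← projHom_le n _ _ h.choose_spec.le]

theorem catchFun_top (n : ℕ) : catchFun n Pointed.top = Flat.top := by
  have h : ¬ ∃ i, Pointed.top = projHom n i := fun ⟨i, h⟩ => projHom_ne_top n i h.symm
  unfold catchFun
  rw [dif_neg h, if_pos rfl]

theorem catchFun_bot (n : ℕ) : catchFun n Pointed.bot = Flat.bot := by
  have h : ¬ ∃ i, Pointed.bot = projHom n i := fun ⟨i, h⟩ => projHom_ne_bot n i h.symm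
  unfold catchFun
  rw [dif_neg h, if_neg (powHom_bot_ne_top n)]

/-- Coherent morphisms `Σ^(n+1) ⇒ Σ` are equal, or both constant. -/
theorem pow_coh_cases (n : ℕ) (f g : Hom (Ty.pow n).Den Ty.sig.Den) (h : Coh f g) :
    f = g ∨ (f = Pointed.bot ∧ g = Pointed.top) ∨ (f = Pointed.top ∧ g = Pointed.bot) := by
  have h' := HomCoh.equiv.symm h
  rcases pow_cases n f with rfl | rfl | ⟨i, rfl⟩ <;>
    rcases pow_cases n g with rfl | rfl | ⟨j, rfl⟩
  · exact Or.inl rfl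
  · exact Or.inr (Or.inl ⟨rfl, rfl⟩)
  · exact absurd h' (projHom_not_coh_bot n j)
  · exact Or.inr (Or.inr ⟨rfl, rfl⟩)
  · exact Or.inl rfl
  · exact absurd h' (projHom_not_coh_top n j)
  · exact absurd h (projHom_not_coh_bot n i)
  · exact absurd h (projHom_not_coh_top n i)
  · exact Or.inl (congrArg _ (projHom_coh n i j h))

/-- The strict bistable function interpreting `catch`. -/
noncomputable def catchHom (n : ℕ) : Hom (Hom (Ty.pow n).Den Ty.sig.Den) (Flat ℕ) :=
  Hom.ofChain (catchFun n)
    (by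
      intro f g hfg
      rcases pow_cases n f with rfl | rfl | ⟨i, rfl⟩
      · rw [catchFun_bot]; exact Or.inl rfl
      · rw [le_antisymm hfg (Pointed.le_top _)]
      · rcases pow_cases n g with rfl | rfl | ⟨j, rfl⟩
        · exact absurd (le_antisymm hfg (Pointed.bot_le _)) (projHom_ne_bot n i)
        · rw [catchFun_top]; exact Or.inr (Or.inl rfl)
        · rw [projHom_le n i j hfg])
    (by
      intro f g h
      rcases pow_coh_cases n f g h with rfl | ⟨rfl, rfl⟩ | ⟨rfl, rfl⟩
      · exact Coh.refl _
      · rw [catchFun_bot, catchFun_top]; exact Pointed.coh_bot_top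
      · rw [catchFun_bot, catchFun_top]; exact Coh.symm Pointed.coh_bot_top)
    (by
      intro f g h
      rcases pow_coh_cases n f g h with rfl | ⟨rfl, rfl⟩ | ⟨rfl, rfl⟩
      · exact Or.inl le_rfl
      · exact Or.inl (Pointed.bot_le _)
      · exact Or.inr (Pointed.bot_le _))
    (by
      intro F s hne hd hs
      rcases pow_cases n s with rfl | rfl | ⟨i, rfl⟩
      · obtain ⟨f, hf⟩ := hne
        rwa [← le_antisymm (hs.1 hf) (Pointed.bot_le _)]
      · obtain ⟨f, hf, hft⟩ := Flat.mem_of_isLUB _ _ (hne.image _) (Hom.directed_eval hd _)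
          (Hom.pointwise_of_isLUB hne hd hs Pointed.bot)
        have : f = Pointed.top := le_antisymm (Pointed.le_top _) fun x =>
          (show (Pointed.top : Ty.sig.Den) = f Pointed.bot from hft.symm).le.trans
            (f.mono (Pointed.bot_le x))
        rwa [← this]
      · obtain ⟨f, hf, hft⟩ := Flat.mem_of_isLUB _ _ (hne.image _) (Hom.directed_eval hd _)
          (Hom.pointwise_of_isLUB hne hd hs Pointed.top)
        have hft' : f Pointed.top = Pointed.top := hft.trans (projHom_top n i)
        have hle := hs.1 hf
        rcases pow_cases n f with rfl | rfl | ⟨j, rfl⟩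
        · exact absurd hft' sig_bot_ne_top
        · exact absurd (le_antisymm (Pointed.le_top _) hle) (projHom_ne_top n i)
        · rwa [← projHom_le n j i hle])

end Catch

/-! ## Terms and their interpretation -/

/-- Variables (de Bruijn indices) of type `T` in a context. -/
inductive Var : List Ty → Ty → Type
  | zero {Γ : List Ty} {T : Ty} : Var (T :: Γ) T
  | succ {Γ : List Ty} {S T : Ty} : Var Γ T → Var (S :: Γ) T

/-- Well-typed terms of SPCF (up to renaming of bound variables). `catch n` stands for the
operator `catch` on `Σ^(n+1) ⇒ Σ`. -/
inductive Term : List Ty → Ty → Type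
  | var {Γ : List Ty} {T : Ty} : Var Γ T → Term Γ T
  | lam {Γ : List Ty} {S T : Ty} : Term (S :: Γ) T → Term Γ (Ty.arr S T)
  | app {Γ : List Ty} {S T : Ty} : Term Γ (Ty.arr S T) → Term Γ S → Term Γ T
  | pair {Γ : List Ty} {S T : Ty} : Term Γ S → Term Γ T → Term Γ (Ty.prod S T)
  | fst {Γ : List Ty} {S T : Ty} : Term Γ (Ty.arr (Ty.prod S T) S)
  | snd {Γ : List Ty} {S T : Ty} : Term Γ (Ty.arr (Ty.prod S T) T)
  | top {Γ : List Ty} : Term Γ Ty.sig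
  | bot {Γ : List Ty} : Term Γ Ty.sig
  | zero {Γ : List Ty} : Term Γ Ty.nat
  | succ {Γ : List Ty} : Term Γ (Ty.arr Ty.nat Ty.nat)
  | pred {Γ : List Ty} : Term Γ (Ty.arr Ty.nat Ty.nat)
  | if0 {Γ : List Ty} (T : Ty) (h : T.IsGround) :
      Term Γ (Ty.arr Ty.nat (Ty.arr (Ty.prod T T) T))
  | fix {Γ : List Ty} (T : Ty) : Term Γ (Ty.arr (Ty.arr T T) T)
  | catch {Γ : List Ty} (n : ℕ) : Term Γ (Ty.arr (Ty.arr (Ty.pow n) Ty.sig) Ty.nat)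

/-- Interpretation of variables as projections. -/
noncomputable def Var.den : {Γ : List Ty} → {T : Ty} → Var Γ T → Hom (CtxDen Γ) T.Den
  | T :: Γ, _, Var.zero => (Hom.snd : Hom (CtxDen Γ × T.Den) T.Den)
  | S :: Γ, T, Var.succ v => (v.den.comp Hom.fst : Hom (CtxDen Γ × S.Den) T.Den)

/-- The successor, strict in both `⊥` and `⊤`. -/
def succHom : Hom (Flat ℕ) (Flat ℕ) := Flat.ext fun n => Flat.val (n + 1)

/-- The predecessor, strict in both `⊥` and `⊤`; the predecessor of zero diverges (there is no
reduction rule for it). -/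
def predHom : Hom (Flat ℕ) (Flat ℕ) := Flat.ext fun n =>
  match n with
  | 0 => Flat.bot
  | n + 1 => Flat.val n

/-- The conditional, strict in both `⊥` and `⊤`. -/
noncomputable def if0Hom (A : Type) [BistableBicpo A] [Pointed A] :
    Hom (Flat ℕ) (Hom (A × A) A) := Flat.ext fun n =>
  match n with
  | 0 => Hom.fst
  | _ + 1 => Hom.snd

/-- The denotation of a term, a morphism from (the interpretation of) its context to
(the interpretation of) its type. -/
noncomputable def Term.den : {Γ : List Ty} → {T : Ty} → Term Γ T → Hom (CtxDen Γ) T.Den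
  | _, _, Term.var v => v.den
  | Γ, _, Term.lam (S := S) (T := T) M =>
    Hom.curry (C := CtxDen Γ) (A := S.Den) (B := T.Den) M.den
  | Γ, _, Term.app (S := S) (T := T) M N =>
    Hom.app (C := CtxDen Γ) (A := S.Den) (B := T.Den) M.den N.den
  | _, _, Term.pair M N => Hom.pair M.den N.den
  | _, _, Term.fst (S := S) (T := T) => Hom.const (Hom.fst : Hom (S.Den × T.Den) S.Den)
  | _, _, Term.snd (S := S) (T := T) => Hom.const (Hom.snd : Hom (S.Den × T.Den) T.Den)
  | _, _, Term.top => Hom.const (Flat.top : Flat Empty)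
  | _, _, Term.bot => Hom.const (Flat.bot : Flat Empty)
  | _, _, Term.zero => Hom.const (Flat.val 0 : Flat ℕ)
  | _, _, Term.succ => Hom.const succHom
  | _, _, Term.pred => Hom.const predHom
  | _, _, Term.if0 T _ => Hom.const (if0Hom T.Den)
  | _, _, Term.fix T => Hom.const (fixHom T.Den)
  | _, _, Term.catch n => Hom.const (catchHom n)

/-! ## Operational semantics -/

/-- Renamings. -/
def Ren (Γ Δ : List Ty) : Type := (T : Ty) → Var Γ T → Var Δ T

/-- Extension of a renaming under a binder. -/
def Ren.lift {Γ Δ : List Ty} (r : Ren Γ Δ) (S : Ty) : Ren (S :: Γ) (S :: Δ)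
  | _, Var.zero => Var.zero
  | _, Var.succ v => Var.succ (r _ v)

/-- Renaming of variables in a term. -/
def Term.rename : {Γ Δ : List Ty} → {T : Ty} → Ren Γ Δ → Term Γ T → Term Δ T
  | _, _, _, r, Term.var v => Term.var (r _ v)
  | _, _, _, r, Term.lam (S := S) M => Term.lam (M.rename (r.lift S))
  | _, _, _, r, Term.app M N => Term.app (M.rename r) (N.rename r)
  | _, _, _, r, Term.pair M N => Term.pair (M.rename r) (N.rename r)
  | _, _, _, _, Term.fst => Term.fst
  | _, _, _, _, Term.snd => Term.snd
  | _, _, _, _, Term.top => Term.top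
  | _, _, _, _, Term.bot => Term.bot
  | _, _, _, _, Term.zero => Term.zero
  | _, _, _, _, Term.succ => Term.succ
  | _, _, _, _, Term.pred => Term.pred
  | _, _, _, _, Term.if0 T h => Term.if0 T h
  | _, _, _, _, Term.fix T => Term.fix T
  | _, _, _, _, Term.catch n => Term.catch n

/-- Simultaneous substitutions. -/
def Sub (Γ Δ : List Ty) : Type := (T : Ty) → Var Γ T → Term Δ T

/-- Extension of a substitution under a binder. -/
def Sub.lift {Γ Δ : List Ty} (s : Sub Γ Δ) (S : Ty) : Sub (S :: Γ) (S :: Δ)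
  | _, Var.zero => Term.var Var.zero
  | _, Var.succ v => (s _ v).rename (fun _ w => Var.succ w)

/-- Capture-avoiding simultaneous substitution. -/
def Term.subst : {Γ Δ : List Ty} → {T : Ty} → Sub Γ Δ → Term Γ T → Term Δ T
  | _, _, _, s, Term.var v => s _ v
  | _, _, _, s, Term.lam (S := S) M => Term.lam (M.subst (s.lift S))
  | _, _, _, s, Term.app M N => Term.app (M.subst s) (N.subst s)
  | _, _, _, s, Term.pair M N => Term.pair (M.subst s) (N.subst s)
  | _, _, _, _, Term.fst => Term.fst
  | _, _, _, _, Term.snd => Term.snd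
  | _, _, _, _, Term.top => Term.top
  | _, _, _, _, Term.bot => Term.bot
  | _, _, _, _, Term.zero => Term.zero
  | _, _, _, _, Term.succ => Term.succ
  | _, _, _, _, Term.pred => Term.pred
  | _, _, _, _, Term.if0 T h => Term.if0 T h
  | _, _, _, _, Term.fix T => Term.fix T
  | _, _, _, _, Term.catch n => Term.catch n

/-- The substitution of `N` for the most recently bound variable. -/
def Sub.single {Γ : List Ty} {S : Ty} (N : Term Γ S) : Sub (S :: Γ) Γ
  | _, Var.zero => N
  | _, Var.succ v => Term.var v

/-- `M[N/x]`, for `x` the most recently bound variable. -/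
def Term.inst {Γ : List Ty} {S T : Ty} (M : Term (S :: Γ) T) (N : Term Γ S) : Term Γ T :=
  M.subst (Sub.single N)

/-- Numerals. -/
def Term.num {Γ : List Ty} : ℕ → Term Γ Ty.nat
  | 0 => Term.zero
  | n + 1 => Term.app Term.succ (Term.num n)

/-- The tuple `⟨f 0, ..., f n⟩ : Σ^(n+1)`. -/
def Term.tuple {Γ : List Ty} : (n : ℕ) → (ℕ → Term Γ Ty.sig) → Term Γ (Ty.pow n)
  | 0, f => f 0
  | n + 1, f => Term.pair (f 0) (Term.tuple n fun i => f (i + 1))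

/-- Closed evaluation contexts, with the type of the hole and the type of the result. -/
inductive ECtx : Ty → Ty → Type
  | hole {A : Ty} : ECtx A A
  | app {A S T : Ty} : ECtx A (Ty.arr S T) → Term [] S → ECtx A T
  | if0 {A : Ty} (T : Ty) (h : T.IsGround) :
      ECtx A Ty.nat → ECtx A (Ty.arr (Ty.prod T T) T)
  | fst {A S T : Ty} : ECtx A (Ty.prod S T) → ECtx A S
  | snd {A S T : Ty} : ECtx A (Ty.prod S T) → ECtx A T
  | succ {A : Ty} : ECtx A Ty.nat → ECtx A Ty.nat
  | pred {A : Ty} : ECtx A Ty.nat → ECtx A Ty.nat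

/-- `E[M]`. -/
def ECtx.fill {A : Ty} : {B : Ty} → ECtx A B → Term [] A → Term [] B
  | _, ECtx.hole, M => M
  | _, ECtx.app E N, M => Term.app (E.fill M) N
  | _, ECtx.if0 T h E, M => Term.app (Term.if0 T h) (E.fill M)
  | _, ECtx.fst E, M => Term.app Term.fst (E.fill M)
  | _, ECtx.snd E, M => Term.app Term.snd (E.fill M)
  | _, ECtx.succ E, M => Term.app Term.succ (E.fill M)
  | _, ECtx.pred E, M => Term.app Term.pred (E.fill M)

/-- Small-step reduction of programs, i.e. closed terms of type `Σ`. -/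
inductive Step : Term [] Ty.sig → Term [] Ty.sig → Prop
  | top (E : ECtx Ty.sig Ty.sig) : Step (E.fill Term.top) Term.top
  | beta {S T : Ty} (E : ECtx T Ty.sig) (M : Term [S] T) (N : Term [] S) :
      Step (E.fill (Term.app (Term.lam M) N)) (E.fill (M.inst N))
  | fst {S T : Ty} (E : ECtx S Ty.sig) (M : Term [] S) (N : Term [] T) :
      Step (E.fill (Term.app Term.fst (Term.pair M N))) (E.fill M)
  | snd {S T : Ty} (E : ECtx T Ty.sig) (M : Term [] S) (N : Term [] T) :
      Step (E.fill (Term.app Term.snd (Term.pair M N))) (E.fill N)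
  | pred (E : ECtx Ty.nat Ty.sig) (n : ℕ) :
      Step (E.fill (Term.app Term.pred (Term.app Term.succ (Term.num n)))) (E.fill (Term.num n))
  | if0_zero {T : Ty} (h : T.IsGround) (E : ECtx (Ty.arr (Ty.prod T T) T) Ty.sig) :
      Step (E.fill (Term.app (Term.if0 T h) Term.zero)) (E.fill Term.fst)
  | if0_succ {T : Ty} (h : T.IsGround) (E : ECtx (Ty.arr (Ty.prod T T) T) Ty.sig) (n : ℕ) :
      Step (E.fill (Term.app (Term.if0 T h) (Term.app Term.succ (Term.num n)))) (E.fill Term.snd)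
  | catch (E : ECtx Ty.nat Ty.sig) (n : ℕ) (M : Term [] (Ty.arr (Ty.pow n) Ty.sig)) :
      Step (E.fill (Term.app (Term.catch n) M))
        (Term.app M (Term.tuple n fun i => E.fill (Term.num i)))
  | fix {T : Ty} (E : ECtx T Ty.sig) (M : Term [] (Ty.arr T T)) :
      Step (E.fill (Term.app (Term.fix T) M)) (E.fill (Term.app M (Term.app (Term.fix T) M)))

/-- `M ⇓`: the program `M` reduces to `⊤`. -/
def Converges (M : Term [] Ty.sig) : Prop := Relation.ReflTransGen Step M Term.top

/-- Contexts `C[·]` with a hole for a term of type `T` in context `Γ` (whose variables `C` may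
capture), with the context and the type of the result. -/
inductive Ctx (Γ : List Ty) (T : Ty) : List Ty → Ty → Type
  | hole : Ctx Γ T Γ T
  | lam {Δ : List Ty} {A B : Ty} : Ctx Γ T (A :: Δ) B → Ctx Γ T Δ (Ty.arr A B)
  | appL {Δ : List Ty} {A B : Ty} : Ctx Γ T Δ (Ty.arr A B) → Term Δ A → Ctx Γ T Δ B
  | appR {Δ : List Ty} {A B : Ty} : Term Δ (Ty.arr A B) → Ctx Γ T Δ A → Ctx Γ T Δ B
  | pairL {Δ : List Ty} {A B : Ty} : Ctx Γ T Δ A → Term Δ B → Ctx Γ T Δ (Ty.prod A B)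
  | pairR {Δ : List Ty} {A B : Ty} : Term Δ A → Ctx Γ T Δ B → Ctx Γ T Δ (Ty.prod A B)

/-- `C[M]`. -/
def Ctx.fill {Γ : List Ty} {T : Ty} : {Δ : List Ty} → {A : Ty} → Ctx Γ T Δ A → Term Γ T → Term Δ A
  | _, _, Ctx.hole, M => M
  | _, _, Ctx.lam C, M => Term.lam (C.fill M)
  | _, _, Ctx.appL C N, M => Term.app (C.fill M) N
  | _, _, Ctx.appR N C, M => Term.app N (C.fill M)
  | _, _, Ctx.pairL C N, M => Term.pair (C.fill M) N
  | _, _, Ctx.pairR N C, M => Term.pair N (C.fill M)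

/-- Observational approximation `M ≲ N`. -/
def ObsLe {Γ : List Ty} {T : Ty} (M N : Term Γ T) : Prop :=
  ∀ C : Ctx Γ T [] Ty.sig, Converges (C.fill M) → Converges (C.fill N)

end SPCF

namespace SPCF

/-! ## Denotations of terms -/

/-! A program converges exactly when it denotes `⊤` (`converges_iff`). One half holds because
reduction preserves denotations (`Step.val_eq`). The other is computational adequacy, by a logical
relation between denotations and closed terms (`Term.rel_subst`). Since the denotation of `C[M]` is
monotone in that of `M` (`Ctx.den_mono`), the order of denotations implies observational
approximation.

For the converse, λ-abstraction reduces open terms to closed ones, and elements not related by the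
order must be separated by a closed test (`exists_test`). This goes by induction on types. At a
function type, `f ≰ g` gives an argument `a` with `f a ≰ g a`. By continuity `a` can be replaced by
one of its truncations `trunc n a`, and it remains to see that truncations are definable
(`trunc_definable`); applying to a defining term then passes to the result type.

Definability is where sequentiality enters. Every type is, up to truncation, a definable retract of
a tuple of copies of `nat` (`Retract.exists_tuple`), and every element of such a tuple is the value
of a closed term. Currying and the distribution of functions over products reduce the claim to `nat
⇒ nat`. A bistable function on numbers is either constant or preserves both `⊥` and `⊤`
(`nat_hom_cases`). The operator `catch` finds out which, and returns the answer as a number. In the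
first case the function is determined by its value at `⊥`; in the second its truncation is
determined by its values at the finitely many numbers below `n`. So finitely many numbers code it
(`Retract.nat_arr_nat`). -/

/-- Application of an element of a function type. -/
def Ty.ap {S T : Ty} (f : (Ty.arr S T).Den) (a : S.Den) : T.Den :=
  Hom.toFun (A := S.Den) (B := T.Den) f a

/-- Pairing of elements of types. -/
def Ty.mk {S T : Ty} (a : S.Den) (b : T.Den) : (Ty.prod S T).Den := (a, b)

/-- First component of an element of a product type. -/
def Ty.p1 {S T : Ty} (x : (Ty.prod S T).Den) : S.Den := Prod.fst (α := S.Den) (β := T.Den) x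

/-- Second component of an element of a product type. -/
def Ty.p2 {S T : Ty} (x : (Ty.prod S T).Den) : T.Den := Prod.snd (α := S.Den) (β := T.Den) x

/-- Extension of an environment. -/
def CtxDen.cons {Γ : List Ty} {S : Ty} (γ : CtxDen Γ) (a : S.Den) : CtxDen (S :: Γ) := (γ, a)

/-- The empty environment. -/
def CtxDen.nil : CtxDen [] := PUnit.unit

theorem Ty.arr_ext {S T : Ty} {f g : (Ty.arr S T).Den} (h : ∀ a, Ty.ap f a = Ty.ap g a) :
    f = g :=
  Hom.ext' (A := S.Den) (B := T.Den) h

section Den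

variable {Γ : List Ty} {S T : Ty}

theorem Term.den_app (M : Term Γ (Ty.arr S T)) (N : Term Γ S) (γ : CtxDen Γ) :
    (Term.app M N).den γ = Ty.ap (M.den γ) (N.den γ) := rfl

theorem Term.den_lam (M : Term (S :: Γ) T) (γ : CtxDen Γ) (a : S.Den) :
    Ty.ap ((Term.lam M).den γ) a = M.den (γ.cons a) := rfl

theorem Term.den_pair (M : Term Γ S) (N : Term Γ T) (γ : CtxDen Γ) :
    (Term.pair M N).den γ = Ty.mk (M.den γ) (N.den γ) := rfl

theorem Term.den_fst (γ : CtxDen Γ) (x : (Ty.prod S T).Den) :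
    Ty.ap (Term.fst.den γ) x = Ty.p1 x := rfl

theorem Term.den_snd (γ : CtxDen Γ) (x : (Ty.prod S T).Den) :
    Ty.ap (Term.snd.den γ) x = Ty.p2 x := rfl

theorem Ty.p1_mk (a : S.Den) (b : T.Den) : Ty.p1 (Ty.mk a b) = a := rfl

theorem Ty.p2_mk (a : S.Den) (b : T.Den) : Ty.p2 (Ty.mk a b) = b := rfl

/-- Renaming of a term amounts to reindexing its environment. -/
theorem Term.den_rename : ∀ {Γ Δ : List Ty} {T : Ty} (M : Term Γ T) (r : Ren Γ Δ) (δ : CtxDen Δ)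
    (γ : CtxDen Γ), (∀ S (v : Var Γ S), (r S v).den δ = v.den γ) →
    (M.rename r).den δ = M.den γ := by
  intro Γ Δ T M
  induction M generalizing Δ with
  | var v => intro r δ γ h; exact h _ v
  | lam M ih =>
    intro r δ γ h
    refine Ty.arr_ext fun a => ih (r.lift _) (δ.cons a) (γ.cons a) fun S v => ?_
    cases v with
    | zero => rfl
    | succ v => exact h _ v
  | app M N ihM ihN =>
    intro r δ γ h
    exact (congrArg₂ Ty.ap (ihM r δ γ h) (ihN r δ γ h))
  | pair M N ihM ihN =>
    intro r δ γ h
    exact (congrArg₂ Ty.mk (ihM r δ γ h) (ihN r δ γ h))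
  | _ => intro r δ γ h; rfl

/-- Substitution in a term amounts to evaluating the substituted terms. -/
theorem Term.den_subst : ∀ {Γ Δ : List Ty} {T : Ty} (M : Term Γ T) (s : Sub Γ Δ) (δ : CtxDen Δ)
    (γ : CtxDen Γ), (∀ S (v : Var Γ S), (s S v).den δ = v.den γ) →
    (M.subst s).den δ = M.den γ := by
  intro Γ Δ T M
  induction M generalizing Δ with
  | var v => intro r δ γ h; exact h _ v
  | lam M ih =>
    intro s δ γ h
    refine Ty.arr_ext fun a => ih (s.lift _) (δ.cons a) (γ.cons a) fun S v => ?_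
    cases v with
    | zero => rfl
    | succ v =>
      exact (Term.den_rename (s _ v) _ (δ.cons a) δ fun _ _ => rfl).trans (h _ v)
  | app M N ihM ihN =>
    intro r δ γ h
    exact (congrArg₂ Ty.ap (ihM r δ γ h) (ihN r δ γ h))
  | pair M N ihM ihN =>
    intro r δ γ h
    exact (congrArg₂ Ty.mk (ihM r δ γ h) (ihN r δ γ h))
  | _ => intro r δ γ h; rfl

theorem Term.den_inst (M : Term (S :: Γ) T) (N : Term Γ S) (γ : CtxDen Γ) :
    (M.inst N).den γ = M.den (γ.cons (N.den γ)) :=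
  Term.den_subst M _ γ _ fun _ v => by cases v <;> rfl

end Den

/-! ## Syntactic substitution -/

section Subst

/-- Lifting a substitution under a binder involves a renaming, so composing two substitutions rests
on the mixed compositions with renamings. The composite `u` is specified pointwise, a form that is
inherited under binders. -/
theorem Term.rename_subst : ∀ {Γ Δ Ξ : List Ty} {T : Ty} (M : Term Γ T) (r : Ren Γ Δ)
    (s : Sub Δ Ξ) (u : Sub Γ Ξ), (∀ S (v : Var Γ S), s S (r S v) = u S v) →
    (M.rename r).subst s = M.subst u := by
  intro Γ Δ Ξ T M
  induction M generalizing Δ Ξ with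
  | var v => intro r s u h; exact h _ v
  | lam M ih =>
    intro r s u h
    refine congrArg Term.lam (ih (r.lift _) (s.lift _) (u.lift _) fun S v => ?_)
    cases v with
    | zero => rfl
    | succ v => exact congrArg (Term.rename _) (h _ v)
  | app M N ihM ihN => intro r s u h; exact congrArg₂ Term.app (ihM r s u h) (ihN r s u h)
  | pair M N ihM ihN => intro r s u h; exact congrArg₂ Term.pair (ihM r s u h) (ihN r s u h)
  | _ => intros; rfl

theorem Term.rename_rename : ∀ {Γ Δ Ξ : List Ty} {T : Ty} (M : Term Γ T) (r : Ren Γ Δ)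
    (s : Ren Δ Ξ) (u : Ren Γ Ξ), (∀ S (v : Var Γ S), s S (r S v) = u S v) →
    (M.rename r).rename s = M.rename u := by
  intro Γ Δ Ξ T M
  induction M generalizing Δ Ξ with
  | var v => intro r s u h; exact congrArg Term.var (h _ v)
  | lam M ih =>
    intro r s u h
    refine congrArg Term.lam (ih (r.lift _) (s.lift _) (u.lift _) fun S v => ?_)
    cases v with
    | zero => rfl
    | succ v => exact congrArg Var.succ (h _ v)
  | app M N ihM ihN => intro r s u h; exact congrArg₂ Term.app (ihM r s u h) (ihN r s u h)
  | pair M N ihM ihN => intro r s u h; exact congrArg₂ Term.pair (ihM r s u h) (ihN r s u h)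
  | _ => intros; rfl

/-- Weakening. -/
def Ren.shift {Γ : List Ty} (S : Ty) : Ren Γ (S :: Γ) := fun _ w => w.succ

theorem Term.subst_rename : ∀ {Γ Δ Ξ : List Ty} {T : Ty} (M : Term Γ T) (s : Sub Γ Δ)
    (r : Ren Δ Ξ) (u : Sub Γ Ξ), (∀ S (v : Var Γ S), (s S v).rename r = u S v) →
    (M.subst s).rename r = M.subst u := by
  intro Γ Δ Ξ T M
  induction M generalizing Δ Ξ with
  | var v => intro r s u h; exact h _ v
  | lam M ih =>
    intro s r u h
    refine congrArg Term.lam (ih (s.lift _) (r.lift _) (u.lift _) fun S v => ?_)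
    cases v with
    | zero => rfl
    | succ v =>
      exact ((s _ v).rename_rename (Ren.shift _) _ (fun _ w => (r _ w).succ) fun _ _ => rfl).trans
        (((s _ v).rename_rename r (Ren.shift _) _ fun _ _ => rfl).symm.trans
          (congrArg (Term.rename (Ren.shift _)) (h _ v)))
  | app M N ihM ihN => intro r s u h; exact congrArg₂ Term.app (ihM r s u h) (ihN r s u h)
  | pair M N ihM ihN => intro r s u h; exact congrArg₂ Term.pair (ihM r s u h) (ihN r s u h)
  | _ => intros; rfl

theorem Term.subst_subst : ∀ {Γ Δ Ξ : List Ty} {T : Ty} (M : Term Γ T) (s : Sub Γ Δ)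
    (t : Sub Δ Ξ) (u : Sub Γ Ξ), (∀ S (v : Var Γ S), (s S v).subst t = u S v) →
    (M.subst s).subst t = M.subst u := by
  intro Γ Δ Ξ T M
  induction M generalizing Δ Ξ with
  | var v => intro r s u h; exact h _ v
  | lam M ih =>
    intro s t u h
    refine congrArg Term.lam (ih (s.lift _) (t.lift _) (u.lift _) fun S v => ?_)
    cases v with
    | zero => rfl
    | succ v =>
      refine ((s _ v).rename_subst _ _ (fun _ w => (t _ w).rename fun _ w => w.succ)
        fun _ _ => rfl).trans ?_
      refine Eq.trans ?_ (congrArg (Term.rename fun _ w => w.succ) (h _ v))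
      exact ((s _ v).subst_rename _ _ _ fun _ _ => rfl).symm
  | app M N ihM ihN => intro r s u h; exact congrArg₂ Term.app (ihM r s u h) (ihN r s u h)
  | pair M N ihM ihN => intro r s u h; exact congrArg₂ Term.pair (ihM r s u h) (ihN r s u h)
  | _ => intros; rfl

theorem Term.subst_id : ∀ {Γ : List Ty} {T : Ty} (M : Term Γ T) (s : Sub Γ Γ),
    (∀ S (v : Var Γ S), s S v = Term.var v) → M.subst s = M := by
  intro Γ T M
  induction M with
  | var v => intro s h; exact h _ v
  | lam M ih =>
    intro s h
    refine congrArg Term.lam (ih (s.lift _) fun S v => ?_)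
    cases v with
    | zero => rfl
    | succ v => exact congrArg (Term.rename _) (h _ v)
  | app M N ihM ihN => intro s h; exact congrArg₂ Term.app (ihM s h) (ihN s h)
  | pair M N ihM ihN => intro s h; exact congrArg₂ Term.pair (ihM s h) (ihN s h)
  | _ => intros; rfl

/-- Extension of a substitution by a term. -/
def Sub.cons {Γ Δ : List Ty} {S : Ty} (s : Sub Γ Δ) (N : Term Δ S) : Sub (S :: Γ) Δ
  | _, Var.zero => N
  | _, Var.succ v => s _ v

/-- The β-reduct of a substituted abstraction is again a single simultaneous substitution, which is
the form needed by the induction in the abstraction case of `Term.rel_subst`. -/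
theorem Term.inst_subst_lift {Γ Δ : List Ty} {S T : Ty} (M : Term (S :: Γ) T) (s : Sub Γ Δ)
    (N : Term Δ S) : (M.subst (s.lift S)).inst N = M.subst (s.cons N) := by
  refine Term.subst_subst M _ _ _ fun _ v => ?_
  cases v with
  | zero => rfl
  | succ v =>
    exact ((s _ v).rename_subst _ _ _ fun _ _ => rfl).trans (Term.subst_id _ _ fun _ _ => rfl)

end Subst

/-! ## Soundness -/

section Soundness

variable {Γ : List Ty}

theorem Term.den_num (γ : CtxDen Γ) (n : ℕ) :
    (Term.num n).den γ = (Flat.val n : Flat ℕ) := by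
  induction n with
  | zero => rfl
  | succ n ih =>
    refine (Term.den_app _ _ _).trans ?_
    rw [ih]
    rfl

/-- The denotation of a closed term. -/
noncomputable def Term.val {T : Ty} (M : Term [] T) : T.Den := M.den CtxDen.nil

theorem Term.val_app {S T : Ty} (M : Term [] (Ty.arr S T)) (N : Term [] S) :
    (Term.app M N).val = Ty.ap M.val N.val := rfl

/-- At function and product types `⊥` is pointwise `⊥`, and `succ`, `pred` and `IF0` are strict.
Together with `ECtx.fill_top` this makes evaluation contexts bistrict, which the rule for `catch`
needs when its argument denotes a constant function. -/
theorem ECtx.fill_bot {A B : Ty} (E : ECtx A B) :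
    ∀ M : Term [] A, M.val = Pointed.bot → (E.fill M).val = Pointed.bot := by
  induction E with
  | hole => exact fun M h => h
  | app E N ih => exact fun M h => congrArg (fun f => Ty.ap f N.val) (ih M h)
  | if0 T h E ih => exact fun M h' => congrArg (Ty.ap (Term.if0 T h).val) (ih M h')
  | fst E ih => exact fun M h => congrArg Ty.p1 (ih M h)
  | snd E ih => exact fun M h => congrArg Ty.p2 (ih M h)
  | succ E ih => exact fun M h => congrArg (Ty.ap Term.succ.val) (ih M h)
  | pred E ih => exact fun M h => congrArg (Ty.ap Term.pred.val) (ih M h)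

theorem ECtx.fill_top {A B : Ty} (E : ECtx A B) :
    ∀ M : Term [] A, M.val = Pointed.top → (E.fill M).val = Pointed.top := by
  induction E with
  | hole => exact fun M h => h
  | app E N ih => exact fun M h => congrArg (fun f => Ty.ap f N.val) (ih M h)
  | if0 T h E ih => exact fun M h' => congrArg (Ty.ap (Term.if0 T h).val) (ih M h')
  | fst E ih => exact fun M h => congrArg Ty.p1 (ih M h)
  | snd E ih => exact fun M h => congrArg Ty.p2 (ih M h)
  | succ E ih => exact fun M h => congrArg (Ty.ap Term.succ.val) (ih M h)
  | pred E ih => exact fun M h => congrArg (Ty.ap Term.pred.val) (ih M h)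

theorem ECtx.fill_congr {A B : Ty} (E : ECtx A B) {M N : Term [] A} (h : M.val = N.val) :
    (E.fill M).val = (E.fill N).val := by
  induction E with
  | hole => exact h
  | app E P ih => exact congrArg (fun f => Ty.ap f P.val) ih
  | if0 T h' E ih => exact congrArg (Ty.ap (Term.if0 T h').val) ih
  | fst E ih => exact congrArg Ty.p1 ih
  | snd E ih => exact congrArg Ty.p2 ih
  | succ E ih => exact congrArg (Ty.ap Term.succ.val) ih
  | pred E ih => exact congrArg (Ty.ap Term.pred.val) ih

theorem projHom_tuple {n : ℕ} (i : Fin (n + 1)) (f : ℕ → Term [] Ty.sig) :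
    projHom n i (Term.tuple n f).val = (f i).val := by
  induction n generalizing f with
  | zero =>
    obtain rfl : i = 0 := Fin.ext (by omega)
    rfl
  | succ n ih =>
    refine Fin.cases ?_ (fun j => ?_) i
    · rfl
    · exact ih j fun k => f (k + 1)

/-! ### The fixpoint operator and invariance of denotations under reduction. -/

theorem fixApprox_mono (A : Type*) [BistableBicpo A] [Pointed A] : Monotone (fixApprox A) :=
  monotone_nat_of_le_succ fun n => by
    induction n with
    | zero => exact fun f => Pointed.bot_le _
    | succ n ih => exact fun f => f.mono (ih f)

theorem fixHom_isLUB (A : Type*) [BistableBicpo A] [Pointed A] (f : Hom A A) :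
    IsLUB (Set.range fun n => fixApprox A n f) (fixHom A f) := by
  have h := Hom.pointwise_of_isLUB (Set.range_nonempty _)
    (directedOn_range.2 (directed_of_isDirected_le (fixApprox_mono A))) (exists_fix A).choose_spec f
  rwa [← Set.range_comp] at h

/-- Continuity of `f` turns the left side into the supremum of the same chain of approximants
shifted by one. -/
theorem fixHom_unfold (A : Type*) [BistableBicpo A] [Pointed A] (f : Hom A A) :
    f (fixHom A f) = fixHom A f := by
  have h := fixHom_isLUB A f
  have hd : DirectedOn (· ≤ ·) (Set.range fun n => fixApprox A n f) :=
    directedOn_range.2 (directed_of_isDirected_le fun _ _ h => fixApprox_mono A h f)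
  have h' := f.cont (Set.range_nonempty _) hd h
  rw [← Set.range_comp] at h'
  apply le_antisymm
  · refine h'.2 ?_
    rintro _ ⟨n, rfl⟩
    exact h.1 ⟨n + 1, rfl⟩
  · refine h.2 ?_
    rintro _ ⟨n, rfl⟩
    exact (fixApprox_mono A n.le_succ f).trans (h'.1 ⟨n, rfl⟩)

theorem Step.val_eq {M N : Term [] Ty.sig} (h : Step M N) : M.val = N.val := by
  cases h with
  | top E => exact E.fill_top _ rfl
  | beta E M N => exact E.fill_congr (M.den_inst N CtxDen.nil).symm
  | fst E M N => exact E.fill_congr rfl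
  | snd E M N => exact E.fill_congr rfl
  | pred E n =>
    refine E.fill_congr ?_
    have h : (Term.num n : Term [] Ty.nat).val = (Flat.val n : Flat ℕ) := Term.den_num _ n
    rw [Term.val_app, Term.val_app, h]
    rfl
  | if0_zero h E => exact E.fill_congr rfl
  | if0_succ h E n =>
    refine E.fill_congr ?_
    have h : (Term.num n : Term [] Ty.nat).val = (Flat.val n : Flat ℕ) := Term.den_num _ n
    rw [Term.val_app, Term.val_app, h]
    rfl
  | fix E M => exact E.fill_congr (fixHom_unfold _ _).symm
  -- The remaining rule, for `catch`, is the only one besides that for `⊤` that does not merely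
  -- rewrite inside the hole. The argument denotes a constant or a projection. A constant passes
  -- through `E` by bistrictness. For the `i`-th projection, both sides denote the value of `E[i]`.
  | _ E n M =>
    rw [Term.val_app]
    have hc : ∀ v : Flat ℕ, catchFun n M.val = v →
      (Term.app (Term.catch n) M).val = v := fun v h => h
    have key : ∀ f : Hom (Ty.pow n).Den Ty.sig.Den, M.val = f →
        (E.fill (Term.app (Term.catch n) M)).val =
          f (Term.tuple n fun i => E.fill (Term.num i)).val := by
      intro f hf
      rcases pow_cases n f with rfl | rfl | ⟨i, rfl⟩
      · exact E.fill_bot _ (hc _ (by rw [hf]; exact catchFun_bot n))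
      · exact E.fill_top _ (hc _ (by rw [hf]; exact catchFun_top n))
      · rw [projHom_tuple]
        refine E.fill_congr ((hc _ (by rw [hf]; exact catchFun_proj n i)).trans ?_)
        exact (Term.den_num _ _).symm
    exact key _ rfl

theorem Converges.val_eq {M : Term [] Ty.sig} (h : Converges M) : M.val = Pointed.top := by
  refine Relation.ReflTransGen.head_induction_on h rfl fun h _ ih => h.val_eq.trans ih

end Soundness

/-! ## Computational adequacy -/

/-- Composition of evaluation contexts. -/
def ECtx.comp {A B : Ty} : {C : Ty} → ECtx B C → ECtx A B → ECtx A C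
  | _, ECtx.hole, F => F
  | _, ECtx.app E N, F => ECtx.app (E.comp F) N
  | _, ECtx.if0 T h E, F => ECtx.if0 T h (E.comp F)
  | _, ECtx.fst E, F => ECtx.fst (E.comp F)
  | _, ECtx.snd E, F => ECtx.snd (E.comp F)
  | _, ECtx.succ E, F => ECtx.succ (E.comp F)
  | _, ECtx.pred E, F => ECtx.pred (E.comp F)

theorem ECtx.fill_comp {A B C : Ty} (E : ECtx B C) (F : ECtx A B) (M : Term [] A) :
    (E.comp F).fill M = E.fill (F.fill M) := by
  induction E with
  | hole => rfl
  | app E N ih => exact congrArg (fun P => Term.app P N) ih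
  | if0 T h E ih => exact congrArg (Term.app (Term.if0 T h)) ih
  | fst E ih => exact congrArg (Term.app Term.fst) ih
  | snd E ih => exact congrArg (Term.app Term.snd) ih
  | succ E ih => exact congrArg (Term.app Term.succ) ih
  | pred E ih => exact congrArg (Term.app Term.pred) ih

/-- `N` converges in every evaluation context in which `M` does. -/
def EvalLe {T : Ty} (M N : Term [] T) : Prop :=
  ∀ E : ECtx T Ty.sig, Converges (E.fill M) → Converges (E.fill N)

theorem EvalLe.fill {A B : Ty} {M N : Term [] A} (h : EvalLe M N) (F : ECtx A B) :
    EvalLe (F.fill M) (F.fill N) := fun E hE => by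
  rw [← ECtx.fill_comp] at hE ⊢
  exact h _ hE

/-- The term `N` is the redex and `M` the reduct: convergence is inherited backwards along
reduction. -/
theorem EvalLe.of_step {T : Ty} {M N : Term [] T}
    (h : ∀ E : ECtx T Ty.sig, Step (E.fill N) (E.fill M)) : EvalLe M N :=
  fun E hE => Relation.ReflTransGen.head (h E) hE

/-- The logical relation between denotations and closed terms. -/
def Rel : (T : Ty) → T.Den → Term [] T → Prop
  | Ty.sig, d, M => d = (Pointed.top : Ty.sig.Den) → Converges M
  -- Terms of type `nat` are not programs, so they are observed through evaluation contexts. The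
  -- value `⊤` aborts the surrounding computation, hence it demands convergence in every context.
  | Ty.nat, d, M => (d = (Flat.top : Flat ℕ) → ∀ E : ECtx Ty.nat Ty.sig, Converges (E.fill M)) ∧
      ∀ n : ℕ, d = (Flat.val n : Flat ℕ) → EvalLe (Term.num n) M
  | Ty.arr S T, d, M => ∀ (a : S.Den) (N : Term [] S), Rel S a N →
      Rel T (Ty.ap d a) (Term.app M N)
  | Ty.prod S T, d, M => Rel S (Ty.p1 d) (Term.app Term.fst M) ∧
      Rel T (Ty.p2 d) (Term.app Term.snd M)

/-- The induction passes through functions and products because applying a term or projecting it is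
itself an evaluation context, and `EvalLe` is stable under those. -/
theorem Rel.expand : ∀ {T : Ty} {d : T.Den} {M N : Term [] T}, EvalLe M N → Rel T d M →
    Rel T d N
  | Ty.sig, _, _, _, h, hM => fun hd => h ECtx.hole (hM hd)
  | Ty.nat, _, _, _, h, hM => ⟨fun hd E => h E (hM.1 hd E), fun n hn E hE => h E (hM.2 n hn E hE)⟩
  | Ty.arr _ _, _, _, _, h, hM => fun a P hP =>
      Rel.expand (h.fill (ECtx.app ECtx.hole P)) (hM a P hP)
  | Ty.prod _ _, _, _, _, h, hM =>
      ⟨Rel.expand (h.fill (ECtx.fst ECtx.hole)) hM.1, Rel.expand (h.fill (ECtx.snd ECtx.hole)) hM.2⟩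

theorem Rel.bot : ∀ {T : Ty} (M : Term [] T), Rel T Pointed.bot M
  | Ty.sig, _ => fun h => absurd h sig_bot_ne_top
  | Ty.nat, _ => ⟨fun h => (by cases h), fun _ h => (by cases h)⟩
  | Ty.arr _ _, _ => fun _ _ _ => Rel.bot _
  | Ty.prod _ _, _ => ⟨Rel.bot _, Rel.bot _⟩

/-- Admissibility, needed for `Y`. At ground types a directed set contains its supremum; at
functions and products suprema are computed pointwise. -/
theorem Rel.sup : ∀ {T : Ty} {X : Set T.Den} {s : T.Den} {M : Term [] T}, X.Nonempty →
    DirectedOn (· ≤ ·) X → IsLUB X s → (∀ d ∈ X, Rel T d M) → Rel T s M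
  | Ty.sig, X, s, _, hne, hd, hs, h => h s (Flat.mem_of_isLUB X s hne hd hs)
  | Ty.nat, X, s, _, hne, hd, hs, h => h s (Flat.mem_of_isLUB X s hne hd hs)
  | Ty.arr S T, X, s, _, hne, hd, hs, h => fun a N hN =>
      Rel.sup (hne.image fun f : Hom S.Den T.Den => f a)
        (Hom.directed_eval (A := S.Den) (B := T.Den) hd a)
        (Hom.pointwise_of_isLUB (A := S.Den) (B := T.Den) hne hd hs a) (by
          rintro _ ⟨f, hf, rfl⟩
          exact h f hf a N hN)
  | Ty.prod S T, X, s, _, hne, hd, hs, h =>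
      ⟨Rel.sup (hne.image Prod.fst) (directed_fst (A := S.Den) (B := T.Den) hd)
        (isLUB_prod.1 hs).1 (by
          rintro _ ⟨x, hx, rfl⟩
          exact (h x hx).1),
      Rel.sup (hne.image Prod.snd) (directed_snd (A := S.Den) (B := T.Den) hd)
        (isLUB_prod.1 hs).2 (by
          rintro _ ⟨x, hx, rfl⟩
          exact (h x hx).2)⟩

theorem Rel.pair {S T : Ty} {a : S.Den} {b : T.Den} {M : Term [] S} {N : Term [] T}
    (hM : Rel S a M) (hN : Rel T b N) : Rel (Ty.prod S T) (Ty.mk a b) (Term.pair M N) :=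
  ⟨Rel.expand (EvalLe.of_step fun E => Step.fst E M N) hM,
    Rel.expand (EvalLe.of_step fun E => Step.snd E M N) hN⟩

/-- The point of `Σ^(n+1)` with value `⊤` exactly at the `i`-th coordinate. -/
theorem exists_rel_tuple {n : ℕ} (i : Fin (n + 1)) (f : ℕ → Term [] Ty.sig)
    (hf : Converges (f i)) : ∃ x : (Ty.pow n).Den,
      projHom n i x = Pointed.top ∧ Rel (Ty.pow n) x (Term.tuple n f) := by
  induction n generalizing f with
  | zero =>
    obtain rfl : i = 0 := Fin.ext (by omega)
    exact ⟨(Pointed.top : Ty.sig.Den), rfl, fun _ => hf⟩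
  | succ n ih =>
    revert hf
    refine Fin.cases (fun hf => ?_) (fun j hf => ?_) i
    · refine ⟨Ty.mk (S := Ty.sig) (T := Ty.pow n) Pointed.top Pointed.bot, rfl, ?_⟩
      exact Rel.pair (S := Ty.sig) (T := Ty.pow n) (fun _ => hf) (Rel.bot _)
    · obtain ⟨x, hx, hr⟩ := ih j (fun k => f (k + 1)) hf
      refine ⟨Ty.mk (S := Ty.sig) (T := Ty.pow n) Pointed.bot x, hx, ?_⟩
      exact Rel.pair (S := Ty.sig) (T := Ty.pow n) (Rel.bot _) hr

/-! ### The constants satisfy the logical relation. -/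

theorem Rel.succ : Rel (Ty.arr Ty.nat Ty.nat) succHom Term.succ := by
  intro a M hM
  revert hM
  cases (show Flat ℕ from a) with
  | bot => exact fun _ => Rel.bot _
  | val n =>
    intro hM
    refine ⟨fun h => (by cases h), fun m hm E hE => ?_⟩
    obtain rfl : n + 1 = m := Flat.val.inj hm
    exact (hM.2 n rfl).fill (ECtx.succ ECtx.hole) E hE
  | top =>
    intro hM
    refine ⟨fun _ E => ?_, fun m hm => (by cases hm)⟩
    have h := hM.1 rfl (E.comp (ECtx.succ ECtx.hole))
    rwa [ECtx.fill_comp] at h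

theorem Rel.pred : Rel (Ty.arr Ty.nat Ty.nat) predHom Term.pred := by
  intro a M hM
  revert hM
  cases (show Flat ℕ from a) with
  | bot => exact fun _ => Rel.bot _
  | val n =>
    intro hM
    cases n with
    | zero => exact Rel.bot _
    | succ n =>
      refine ⟨fun h => (by cases h), fun m hm E hE => ?_⟩
      obtain rfl : n = m := Flat.val.inj hm
      exact (hM.2 (n + 1) rfl).fill (ECtx.pred ECtx.hole) E
        (Relation.ReflTransGen.head (Step.pred E n) hE)
  | top =>
    intro hM
    refine ⟨fun _ E => ?_, fun m hm => (by cases hm)⟩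
    have h := hM.1 rfl (E.comp (ECtx.pred ECtx.hole))
    rwa [ECtx.fill_comp] at h

theorem Rel.top_of_ground {T : Ty} (hT : T.IsGround) {M : Term [] T}
    (h : ∀ E : ECtx T Ty.sig, Converges (E.fill M)) : Rel T Pointed.top M := by
  rcases hT with rfl | rfl
  · exact fun _ => h ECtx.hole
  · exact ⟨fun _ => h, fun n hn => (by cases hn)⟩

theorem Rel.if0 {T : Ty} (h : T.IsGround) :
    Rel (Ty.arr Ty.nat (Ty.arr (Ty.prod T T) T)) (if0Hom T.Den) (Term.if0 T h) := by
  intro a M hM p P hP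
  -- If `a` is the number `n`, then `IF0 M P` converges wherever `IF0 n P` does. It then suffices to
  -- reduce the latter to a projection applied to `P`.
  have fill := fun n (ha : a = (Flat.val n : Flat ℕ)) =>
    ((hM.2 n ha).fill (ECtx.if0 T h ECtx.hole)).fill (ECtx.app ECtx.hole P)
  revert hM fill
  cases (show Flat ℕ from a) with
  | bot => exact fun _ _ => Rel.bot _
  | val n =>
    intro _ fill
    cases n with
    | zero =>
      refine Rel.expand (fun E hE => fill 0 rfl E ?_) hP.1
      have h' := Step.if0_zero h (E.comp (ECtx.app ECtx.hole P))
      rw [ECtx.fill_comp, ECtx.fill_comp] at h'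
      exact Relation.ReflTransGen.head h' hE
    | succ n =>
      refine Rel.expand (fun E hE => fill (n + 1) rfl E ?_) hP.2
      have h' := Step.if0_succ h (E.comp (ECtx.app ECtx.hole P)) n
      rw [ECtx.fill_comp, ECtx.fill_comp] at h'
      exact Relation.ReflTransGen.head h' hE
  | top =>
    intro hM _
    refine Rel.top_of_ground h fun E => ?_
    have h' := hM.1 rfl ((E.comp (ECtx.app ECtx.hole P)).comp (ECtx.if0 T h ECtx.hole))
    rwa [ECtx.fill_comp, ECtx.fill_comp] at h'

/-- After the step, `M` is applied to the tuple of all `E[k]`. If `M` is related to `⊤`, it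
converges on every tuple, since `⊥` is related to all terms. If it is related to the `i`-th
projection, convergence of `E[i]` alone makes the tuple related to a point with `i`-th coordinate
`⊤`, whatever the other entries do. -/
theorem Rel.catch (n : ℕ) :
    Rel (Ty.arr (Ty.arr (Ty.pow n) Ty.sig) Ty.nat) (catchHom n) (Term.catch n) := by
  intro f M hM
  have key : ∀ g : Hom (Ty.pow n).Den Ty.sig.Den, f = g →
      Rel Ty.nat (catchFun n g) (Term.app (Term.catch n) M) := by
    intro g hg
    rcases pow_cases n g with rfl | rfl | ⟨i, rfl⟩
    · rw [catchFun_bot]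
      exact Rel.bot _
    · rw [catchFun_top]
      refine ⟨fun _ E => ?_, fun m hm => (by cases hm)⟩
      exact Relation.ReflTransGen.head (Step.catch E n M)
        (hM Pointed.bot _ (Rel.bot _) (by rw [hg]; rfl))
    · rw [catchFun_proj]
      refine ⟨fun h => (by cases h), fun m hm E hE => ?_⟩
      obtain rfl : i.val = m := Flat.val.inj hm
      obtain ⟨x, hx, hr⟩ := exists_rel_tuple i (fun k => E.fill (Term.num k)) hE
      exact Relation.ReflTransGen.head (Step.catch E n M) (hM x _ hr (by rw [hg]; exact hx))
  exact key f rfl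

/-- By admissibility only the finite approximants matter, and each of them costs one unfolding of `Y
M`. -/
theorem Rel.fix (T : Ty) : Rel (Ty.arr (Ty.arr T T) T) (fixHom T.Den) (Term.fix T) := by
  intro f M hM
  refine Rel.sup (Set.range_nonempty _) (directedOn_range.2 (directed_of_isDirected_le
    fun _ _ h => fixApprox_mono T.Den h f)) (fixHom_isLUB T.Den f) ?_
  rintro _ ⟨n, rfl⟩
  induction n with
  | zero => exact Rel.bot _
  | succ n ih => exact Rel.expand (EvalLe.of_step fun E => Step.fix E M) (hM _ _ ih)

/-- The fundamental property of the logical relation. -/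
theorem Term.rel_subst : ∀ {Γ : List Ty} {T : Ty} (M : Term Γ T) (γ : CtxDen Γ) (s : Sub Γ []),
    (∀ S (v : Var Γ S), Rel S (v.den γ) (s S v)) → Rel T (M.den γ) (M.subst s) := by
  intro Γ T M
  induction M with
  | var v => exact fun γ s h => h _ v
  | lam M ih =>
    intro γ s h a N hN
    refine Rel.expand (EvalLe.of_step fun E => Step.beta E (M.subst (s.lift _)) N) ?_
    rw [Term.inst_subst_lift]
    refine ih (γ.cons a) (s.cons N) fun S v => ?_
    cases v with
    | zero => exact hN
    | succ v => exact h _ v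
  | app M N ihM ihN => exact fun γ s h => ihM γ s h _ _ (ihN γ s h)
  | pair M N ihM ihN => exact fun γ s h => Rel.pair (ihM γ s h) (ihN γ s h)
  | fst => exact fun _ _ _ _ _ hN => hN.1
  | snd => exact fun _ _ _ _ _ hN => hN.2
  | top => exact fun _ _ _ _ => Relation.ReflTransGen.refl
  | bot => exact fun _ _ _ => Rel.bot _
  | zero =>
    refine fun _ _ _ => ⟨fun h => (by cases h), fun n hn => ?_⟩
    obtain rfl : 0 = n := Flat.val.inj hn
    exact fun _ h => h
  | succ => exact fun _ _ _ => Rel.succ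
  | pred => exact fun _ _ _ => Rel.pred
  | if0 T h => exact fun _ _ _ => Rel.if0 h
  | fix T => exact fun _ _ _ => Rel.fix T
  | _ n => exact fun _ _ _ => Rel.catch n

/-- A program converges if and only if it denotes `⊤`. -/
theorem converges_iff (M : Term [] Ty.sig) : Converges M ↔ M.val = Pointed.top := by
  refine ⟨Converges.val_eq, fun h => ?_⟩
  have hM := M.rel_subst CtxDen.nil (fun _ v => Term.var v) (fun _ v => nomatch v)
  rw [Term.subst_id M _ fun _ _ => rfl] at hM
  exact hM h

/-! ## Truncations -/

/-- The morphism that keeps the numbers below `n` and sends the others to `⊥`. -/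
def natTrunc (n : ℕ) : Hom (Flat ℕ) (Flat ℕ) :=
  Flat.ext fun k => if k < n then Flat.val k else Flat.bot

/-- The finite approximations of the identity of a type. -/
noncomputable def trunc (n : ℕ) : (T : Ty) → Hom T.Den T.Den
  | Ty.sig => (Hom.id : Hom (Flat Empty) (Flat Empty))
  | Ty.nat => natTrunc n
  | Ty.arr S T => (Hom.curry ((trunc n T).comp (Hom.app Hom.fst ((trunc n S).comp Hom.snd))) :
      Hom (Hom S.Den T.Den) (Hom S.Den T.Den))
  | Ty.prod S T => (Hom.pair ((trunc n S).comp Hom.fst) ((trunc n T).comp Hom.snd) :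
      Hom (S.Den × T.Den) (S.Den × T.Den))

section Trunc

variable {S T : Ty}

theorem trunc_arr (n : ℕ) (f : (Ty.arr S T).Den) (a : S.Den) :
    Ty.ap (trunc n (Ty.arr S T) f) a = trunc n T (Ty.ap f (trunc n S a)) := rfl

theorem p1_trunc (n : ℕ) (x : (Ty.prod S T).Den) :
    Ty.p1 (trunc n (Ty.prod S T) x) = trunc n S (Ty.p1 x) := rfl

theorem p2_trunc (n : ℕ) (x : (Ty.prod S T).Den) :
    Ty.p2 (trunc n (Ty.prod S T) x) = trunc n T (Ty.p2 x) := rfl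

theorem Ty.prod_ext {x y : (Ty.prod S T).Den} (h1 : Ty.p1 x = Ty.p1 y)
    (h2 : Ty.p2 x = Ty.p2 y) : x = y := Prod.ext h1 h2

theorem natTrunc_val {n k : ℕ} (h : k < n) : natTrunc n (Flat.val k) = Flat.val k :=
  if_pos h

theorem natTrunc_val_of_le {n k : ℕ} (h : n ≤ k) : natTrunc n (Flat.val k) = Flat.bot :=
  if_neg h.not_gt

theorem natTrunc_mono (x : Flat ℕ) : Monotone fun n => natTrunc n x := by
  intro m n h
  cases x with
  | bot => exact le_rfl
  | top => exact le_rfl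
  | val k =>
    change natTrunc m (Flat.val k) ≤ natTrunc n (Flat.val k)
    rcases lt_or_ge k m with hk | hk
    · rw [natTrunc_val hk, natTrunc_val (hk.trans_le h)]
    · rw [natTrunc_val_of_le hk]
      exact Or.inl rfl

theorem natTrunc_isLUB (x : Flat ℕ) : IsLUB (Set.range fun n => natTrunc n x) x := by
  cases x with
  | bot => exact (Set.range_const (ι := ℕ) (c := (Flat.bot : Flat ℕ))).symm ▸ isLUB_singleton
  | top => exact (Set.range_const (ι := ℕ) (c := (Flat.top : Flat ℕ))).symm ▸ isLUB_singleton
  | val k =>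
    refine ⟨?_, fun u hu => hu ⟨k + 1, natTrunc_val k.lt_succ_self⟩⟩
    rintro _ ⟨n, rfl⟩
    change natTrunc n (Flat.val k) ≤ Flat.val k
    rcases lt_or_ge k n with hk | hk
    · rw [natTrunc_val hk]
    · rw [natTrunc_val_of_le hk]
      exact Or.inl rfl

/-- The truncations of an element form a chain whose supremum is the element. -/
theorem trunc_spec : ∀ (T : Ty) (x : T.Den),
    Monotone (fun n => trunc n T x) ∧ IsLUB (Set.range fun n => trunc n T x) x
  | Ty.sig, x => ⟨fun _ _ _ => le_rfl, (Set.range_const (ι := ℕ) (c := x)).symm ▸ isLUB_singleton⟩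
  | Ty.nat, x => ⟨natTrunc_mono x, natTrunc_isLUB x⟩
  | Ty.prod S T, x => by
    obtain ⟨m1, l1⟩ := trunc_spec S (Ty.p1 x)
    obtain ⟨m2, l2⟩ := trunc_spec T (Ty.p2 x)
    refine ⟨fun _ _ h => ⟨m1 h, m2 h⟩, isLUB_prod.2 ⟨?_, ?_⟩⟩
    · exact (Set.range_comp (Prod.fst (α := S.Den) (β := T.Den))
        fun n => trunc n (Ty.prod S T) x).subst (motive := fun X => IsLUB X _) l1
    · exact (Set.range_comp (Prod.snd (α := S.Den) (β := T.Den))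
        fun n => trunc n (Ty.prod S T) x).subst (motive := fun X => IsLUB X _) l2
  | Ty.arr S T, f => by
    have hS := trunc_spec S
    have hT := trunc_spec T
    have hm : ∀ (a : S.Den) {i j k l : ℕ}, i ≤ k → j ≤ l →
        trunc i T (Ty.ap f (trunc j S a)) ≤ trunc k T (Ty.ap f (trunc l S a)) :=
      fun a i j k l h h' => ((hT _).1 h).trans
        ((trunc k T).mono (Hom.mono (A := S.Den) (B := T.Den) f ((hS a).1 h')))
    refine ⟨fun m n h a => hm a h h, ?_, fun u hu a => ?_⟩
    · rintro _ ⟨n, rfl⟩ a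
      exact ((hT _).2.1 ⟨n, rfl⟩).trans
        (Hom.mono (A := S.Den) (B := T.Den) f ((hS a).2.1 ⟨n, rfl⟩))
    -- The value `f a` is a double supremum: over truncations of the argument, by continuity, and
    -- over truncations of the result. By monotonicity in both indices the diagonal is cofinal.
    · have hc := Hom.cont (A := S.Den) (B := T.Den) f (Set.range_nonempty fun n => trunc n S a)
        (directedOn_range.2 (directed_of_isDirected_le (hS a).1)) (hS a).2
      refine hc.2 ?_
      rintro _ ⟨_, ⟨m, rfl⟩, rfl⟩
      refine (hT _).2.2 ?_
      rintro _ ⟨n, rfl⟩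
      exact (hm a (le_max_left n m) (le_max_right n m)).trans (hu ⟨max n m, rfl⟩ a)

end Trunc

/-! ## Definable retractions -/

/-- The renaming from the empty context. -/
def Ren.ofNil (Γ : List Ty) : Ren [] Γ := fun _ v => nomatch v

/-- A closed term in an arbitrary context. -/
def Term.wk {Γ : List Ty} {T : Ty} (M : Term [] T) : Term Γ T := M.rename (Ren.ofNil Γ)

theorem Term.den_wk {Γ : List Ty} {T : Ty} (M : Term [] T) (γ : CtxDen Γ) :
    (M.wk : Term Γ T).den γ = M.val :=
  M.den_rename _ _ _ fun _ v => nomatch v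

theorem Term.val_lam {S T : Ty} (M : Term [S] T) (a : S.Den) :
    Ty.ap (Term.lam M).val a = M.den (CtxDen.nil.cons a) := rfl

section Variables

variable {Γ : List Ty} {S T U : Ty}

/-- The variable bound last. -/
def Term.v0 : Term (S :: Γ) S := Term.var Var.zero

/-- The variable bound last but one. -/
def Term.v1 : Term (T :: S :: Γ) S := Term.var Var.zero.succ

/-- The variable bound last but two. -/
def Term.v2 : Term (U :: T :: S :: Γ) S := Term.var Var.zero.succ.succ

theorem Term.den_v0 (γ : CtxDen Γ) (a : S.Den) : Term.v0.den (γ.cons a) = a := rfl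

theorem Term.den_v1 (γ : CtxDen Γ) (a : S.Den) (b : T.Den) :
    Term.v1.den ((γ.cons a).cons b) = a := rfl

end Variables

/-- `T` is a definable retract of `U`, up to truncation at `n`. -/
def Retract (n : ℕ) (T U : Ty) : Prop :=
  ∃ (R : Term [] (Ty.arr U T)) (S : Term [] (Ty.arr T U)),
    ∀ x, Ty.ap R.val (trunc n U (Ty.ap S.val x)) = trunc n T x

section Retract

variable {n : ℕ} {S T U V W : Ty}

open Term (v0 v1 v2 wk lam app pair)

theorem Retract.refl : Retract n T T := ⟨lam v0, lam v0, fun _ => rfl⟩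

/-- The inner composite collapses to the truncation at the middle type, which is exactly what the
outer retraction expects between its two maps. -/
theorem Retract.trans : Retract n S T → Retract n T U → Retract n S U := by
  rintro ⟨R, P, h⟩ ⟨R', P', h'⟩
  refine ⟨lam (app R.wk (app R'.wk v0)), lam (app P'.wk (app P.wk v0)), fun x => ?_⟩
  simp only [Term.val_lam, Term.den_app, Term.den_wk, Term.den_v0, h, h']

theorem Retract.prod : Retract n S U → Retract n T V →
    Retract n (Ty.prod S T) (Ty.prod U V) := by
  rintro ⟨R, P, h⟩ ⟨R', P', h'⟩
  refine ⟨lam (pair (app R.wk (app Term.fst v0)) (app R'.wk (app Term.snd v0))),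
    lam (pair (app P.wk (app Term.fst v0)) (app P'.wk (app Term.snd v0))),
    fun x => Ty.prod_ext ?_ ?_⟩ <;>
  simp only [Term.val_lam, Term.den_app, Term.den_wk, Term.den_v0, Term.den_pair, Term.den_fst,
    Term.den_snd, p1_trunc, p2_trunc, Ty.p1_mk, Ty.p2_mk, h, h']

/-- The section precomposes with the retraction of the domain and postcomposes with the section of
the codomain; the retraction does the opposite. Truncating the code truncates argument and result at
once. -/
theorem Retract.arr : Retract n S U → Retract n T V →
    Retract n (Ty.arr S T) (Ty.arr U V) := by
  rintro ⟨R, P, h⟩ ⟨R', P', h'⟩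
  refine ⟨lam (lam (app R'.wk (app v1 (app P.wk v0)))),
    lam (lam (app P'.wk (app v1 (app R.wk v0)))), fun x => Ty.arr_ext fun a => ?_⟩
  simp only [Term.val_lam, Term.den_lam, Term.den_app, Term.den_wk, Term.den_v0, Term.den_v1,
    trunc_arr, h, h']

/-- Truncation acts componentwise on pairs and on each argument separately, so it commutes with
currying on the nose. -/
theorem Retract.curry :
    Retract n (Ty.arr (Ty.prod S T) U) (Ty.arr S (Ty.arr T U)) :=
  ⟨lam (lam (app (app v1 (app Term.fst v0)) (app Term.snd v0))),
    lam (lam (lam (app v2 (pair v1 v0)))), fun _ => Ty.arr_ext fun _ => rfl⟩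

theorem Retract.arr_prod :
    Retract n (Ty.arr S (Ty.prod T U)) (Ty.prod (Ty.arr S T) (Ty.arr S U)) :=
  ⟨lam (lam (pair (app (app Term.fst v1) v0) (app (app Term.snd v1) v0))),
    lam (pair (lam (app Term.fst (app v1 v0))) (lam (app Term.snd (app v1 v0)))),
    fun _ => Ty.arr_ext fun _ => rfl⟩

end Retract

/-! ## Coding of functions on numbers -/

/-- A number, as an element of `nat`. -/
def natVal (n : ℕ) : Ty.nat.Den := (Flat.val n : Flat ℕ)

theorem nat_cases (x : Ty.nat.Den) :
    x = Pointed.bot ∨ x = Pointed.top ∨ ∃ n, x = natVal n := by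
  cases (show Flat ℕ from x) with
  | bot => exact Or.inl rfl
  | val n => exact Or.inr (Or.inr ⟨n, rfl⟩)
  | top => exact Or.inr (Or.inl rfl)

theorem natVal_inj {m n : ℕ} : natVal m = natVal n ↔ m = n :=
  ⟨fun h => Flat.val.inj h, congrArg natVal⟩

theorem natVal_ne_bot (n : ℕ) : natVal n ≠ Pointed.bot := fun h => by cases h

theorem natVal_ne_top (n : ℕ) : natVal n ≠ Pointed.top := fun h => by cases h

theorem nat_bot_ne_top : (Pointed.bot : Ty.nat.Den) ≠ Pointed.top := fun h => by cases h

theorem nat_le_iff {x y : Ty.nat.Den} : x ≤ y ↔ x = Pointed.bot ∨ y = Pointed.top ∨ x = y :=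
  Iff.rfl

theorem trunc_bot_nat (n : ℕ) : trunc n Ty.nat Pointed.bot = Pointed.bot := rfl

theorem trunc_top_nat (n : ℕ) : trunc n Ty.nat Pointed.top = Pointed.top := rfl

theorem trunc_natVal {n k : ℕ} (h : k < n) : trunc n Ty.nat (natVal k) = natVal k :=
  natTrunc_val h

theorem trunc_natVal_of_le {n k : ℕ} (h : n ≤ k) : trunc n Ty.nat (natVal k) = Pointed.bot :=
  natTrunc_val_of_le h

/-- Tuples of numbers. -/
inductive IsTuple : Ty → Prop
  | nat : IsTuple Ty.nat
  | prod {S T : Ty} : IsTuple S → IsTuple T → IsTuple (Ty.prod S T)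

/-- The inclusion of `Σ` in `nat`. -/
def Term.ofSig : Term [] (Ty.arr Ty.sig Ty.nat) :=
  Term.lam (Term.app (Term.catch 0) (Term.lam Term.v1))

theorem Term.ofSig_bot : Ty.ap Term.ofSig.val Pointed.bot = Pointed.bot := catchFun_bot 0

theorem Term.ofSig_top : Ty.ap Term.ofSig.val Pointed.top = Pointed.top := catchFun_top 0

/-- The term `⊥` of type `nat`. -/
def Term.natBot : Term [] Ty.nat := Term.app Term.ofSig Term.bot

theorem Term.natBot_val : Term.natBot.val = Pointed.bot := Term.ofSig_bot

theorem Ty.isGround_sig : Ty.sig.IsGround := Or.inl rfl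

theorem Ty.isGround_nat : Ty.nat.IsGround := Or.inr rfl

/-- The branching `IF0 M ⟨N, P⟩`. -/
def Term.ite {Γ : List Ty} {T : Ty} (h : T.IsGround) (M : Term Γ Ty.nat) (N P : Term Γ T) :
    Term Γ T :=
  Term.app (Term.app (Term.if0 T h) M) (Term.pair N P)

/-- The meaning of branching. -/
noncomputable def natIte {T : Ty} (x : Ty.nat.Den) (a b : T.Den) : T.Den :=
  Flat.ext (fun k => match k with | 0 => a | _ + 1 => b) x

section Branching

variable {T : Ty} (a b : T.Den)

theorem natIte_zero : natIte (natVal 0) a b = a := rfl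

theorem natIte_succ (k : ℕ) : natIte (natVal (k + 1)) a b = b := rfl

theorem Term.den_ite {Γ : List Ty} (h : T.IsGround) (M : Term Γ Ty.nat)
    (N P : Term Γ T) (γ : CtxDen Γ) :
    (Term.ite h M N P).den γ = natIte (M.den γ) (N.den γ) (P.den γ) := by
  change Ty.ap (Ty.ap ((Term.if0 T h).den γ) (M.den γ)) (Ty.mk (N.den γ) (P.den γ)) = _
  generalize M.den γ = x
  rcases nat_cases x with rfl | rfl | ⟨_ | k, rfl⟩ <;> rfl

end Branching

/-- The map back only has to be right at `⊥` and `⊤`, which bistrictness of `IF0` ensures for any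
choice of branches. -/
theorem Retract.sig_nat {n : ℕ} : Retract n Ty.sig Ty.nat := by
  refine ⟨Term.lam (Term.ite Ty.isGround_sig Term.v0 Term.bot Term.bot), Term.ofSig, fun x => ?_⟩
  rw [Term.val_lam, Term.den_ite]
  rcases sig_cases x with rfl | rfl
  · rw [Term.ofSig_bot]
    rfl
  · rw [Term.ofSig_top]
    rfl

/-! ### Strict and constant functions on numbers, told apart by `catch`. -/

/-- A function on numbers is bistrict or constant. -/
theorem nat_hom_cases (f : (Ty.arr Ty.nat Ty.nat).Den) :
    (Ty.ap f Pointed.bot = Pointed.bot ∧ Ty.ap f Pointed.top = Pointed.top) ∨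
      ∃ c, ∀ x, Ty.ap f x = c := by
  have hb : ∀ x, Ty.ap f Pointed.bot ≤ Ty.ap f x := fun x =>
    Hom.mono (A := Ty.nat.Den) (B := Ty.nat.Den) f (Pointed.bot_le x)
  have ht : ∀ x, Ty.ap f x ≤ Ty.ap f Pointed.top := fun x =>
    Hom.mono (A := Ty.nat.Den) (B := Ty.nat.Den) f (Pointed.le_top x)
  -- The elements `⊥` and `⊤` are coherent, hence so are their images: these are equal or both lie
  -- in `{⊥, ⊤}`. If they are equal, monotonicity squeezes every other value between them.
  have hc : Flat.FCoh (Ty.ap f Pointed.bot) (Ty.ap f Pointed.top) :=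
    Hom.map_coh (A := Ty.nat.Den) (B := Ty.nat.Den) f Pointed.coh_bot_top
  have of_eq : Ty.ap f Pointed.bot = Ty.ap f Pointed.top → ∃ c, ∀ x, Ty.ap f x = c :=
    fun h => ⟨_, fun x => le_antisymm ((ht x).trans h.ge) (hb x)⟩
  rcases hc with h | ⟨h1 | h1, h2 | h2⟩
  · exact Or.inr (of_eq h)
  · exact Or.inr (of_eq (h1.trans h2.symm))
  · exact Or.inl ⟨h1, h2⟩
  · refine Or.inr (of_eq ((le_antisymm (hb _) ?_)))
    exact h2.le.trans (Pointed.bot_le (Ty.ap f Pointed.bot))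
  · exact Or.inr (of_eq (h1.trans h2.symm))

/-- The term deciding whether a function on numbers evaluates its argument. -/
def Term.strictness : Term [] (Ty.arr (Ty.arr Ty.nat Ty.nat) Ty.nat) :=
  -- The function given to `catch` sends `(x, y)` to `IF0 (f x) ⟨y, y⟩`, with `x` included in `nat`.
  -- It is the first projection if `f` is bistrict and the second if `f` is constantly a number, so
  -- the answers are `0` and `1`.
  Term.lam (Term.app (Term.catch 1) (Term.lam (S := Ty.prod Ty.sig Ty.sig)
    (Term.ite Ty.isGround_sig
      (Term.app Term.v1 (Term.app Term.ofSig.wk (Term.app Term.fst Term.v0)))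
      (Term.app Term.snd Term.v0) (Term.app Term.snd Term.v0))))

theorem Term.strictness_eq (f : (Ty.arr Ty.nat Ty.nat).Den) (g : Hom (Ty.pow 1).Den Ty.sig.Den)
    (h : ∀ x y : Ty.sig.Den,
      natIte (T := Ty.sig) (Ty.ap f (Ty.ap Term.ofSig.val x)) y y = g (x, y)) :
    Ty.ap Term.strictness.val f = catchFun 1 g := by
  refine congrArg (catchFun 1) (Ty.arr_ext (S := Ty.prod Ty.sig Ty.sig) (T := Ty.sig)
    (f := (Term.lam _).den (CtxDen.nil.cons f)) (g := g) fun p => ?_)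
  rw [Term.den_lam, Term.den_ite]
  simp only [Term.den_app, Term.den_wk, Term.den_v0, Term.den_v1, Term.den_fst, Term.den_snd]
  exact h (Ty.p1 p) (Ty.p2 p)

theorem Term.strictness_strict (f : (Ty.arr Ty.nat Ty.nat).Den)
    (hb : Ty.ap f Pointed.bot = Pointed.bot) (ht : Ty.ap f Pointed.top = Pointed.top) :
    Ty.ap Term.strictness.val f = natVal 0 := by
  refine (Term.strictness_eq f (projHom 1 0) fun x y => ?_).trans (catchFun_proj 1 0)
  rcases sig_cases x with rfl | rfl
  · rw [Term.ofSig_bot, hb]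
    rfl
  · rw [Term.ofSig_top, ht]
    rfl

/-- The conditional with equal branches covers the three kinds of constant together: the answer is
`1` for a number, while a constant `⊥` or `⊤` makes the answer itself `⊥` or `⊤`. -/
theorem Term.strictness_const (f : (Ty.arr Ty.nat Ty.nat).Den) (c : Ty.nat.Den)
    (h : ∀ x, Ty.ap f x = c) :
    Ty.ap Term.strictness.val f = natIte (T := Ty.nat) c (natVal 1) (natVal 1) := by
  rcases nat_cases c with rfl | rfl | ⟨k, rfl⟩
  · refine (Term.strictness_eq f Pointed.bot fun x y => ?_).trans (catchFun_bot 1)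
    rw [h]
    rfl
  · refine (Term.strictness_eq f Pointed.top fun x y => ?_).trans (catchFun_top 1)
    rw [h]
    rfl
  · refine (Term.strictness_eq f (projHom 1 1) fun x y => ?_).trans ((catchFun_proj 1 1).trans ?_)
    · rw [h]
      cases k <;> rfl
    · cases k <;> rfl

/-- The bistrict function with finitely many given values, `⊥` at the other numbers. -/
noncomputable def natTable (k : ℕ) (g : ℕ → Ty.nat.Den) (x : Ty.nat.Den) : Ty.nat.Den :=
  Flat.ext (fun i => if i < k then g i else Pointed.bot) x

theorem natTable_bot (k : ℕ) (g : ℕ → Ty.nat.Den) : natTable k g Pointed.bot = Pointed.bot := rfl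

theorem natTable_top (k : ℕ) (g : ℕ → Ty.nat.Den) : natTable k g Pointed.top = Pointed.top := rfl

theorem natTable_natVal (k : ℕ) (g : ℕ → Ty.nat.Den) (i : ℕ) :
    natTable k g (natVal i) = if i < k then g i else Pointed.bot := rfl

/-- The finite part of a bistrict function on numbers can be coded by a tuple of numbers. -/
theorem exists_table (n k : ℕ) : ∃ U, IsTuple U ∧
    ∃ (R : Term [] (Ty.arr U (Ty.arr Ty.nat Ty.nat)))
      (S : Term [] (Ty.arr (Ty.arr Ty.nat Ty.nat) U)),
      ∀ (f : (Ty.arr Ty.nat Ty.nat).Den) (x : Ty.nat.Den),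
        Ty.ap (Ty.ap R.val (trunc n U (Ty.ap S.val f))) x =
          natTable k (fun i => trunc n Ty.nat (Ty.ap f (natVal i))) x := by
  induction k with
  | zero =>
    -- The empty table still needs a type for its code. There is no unit type, so a dummy number `0`
    -- is stored and never read. The decoded function must nevertheless be bistrict, whence the
    -- conditional with both branches `⊥`.
    refine ⟨Ty.nat, IsTuple.nat, Term.lam (Term.lam (Term.ite Ty.isGround_nat Term.v0
      Term.natBot.wk Term.natBot.wk)), Term.lam Term.zero, fun f x => ?_⟩
    rw [Term.val_lam, Term.den_lam, Term.den_ite, Term.den_wk, Term.natBot_val, Term.den_v0]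
    rcases nat_cases x with rfl | rfl | ⟨_ | k, rfl⟩ <;> rfl
  | succ k ih =>
    obtain ⟨U, hU, R, S, h⟩ := ih
    -- A table of `k + 1` values consists of `f 0` and a table for `f ∘ succ`. Looking up `x`
    -- branches on whether `x` is zero and otherwise looks up the predecessor in the rest.
    refine ⟨Ty.prod Ty.nat U, IsTuple.prod IsTuple.nat hU,
      Term.lam (Term.lam (Term.ite Ty.isGround_nat Term.v0 (Term.app Term.fst Term.v1)
        (Term.app (Term.app R.wk (Term.app Term.snd Term.v1)) (Term.app Term.pred Term.v0)))),
      Term.lam (Term.pair (Term.app Term.v0 Term.zero)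
        (Term.app S.wk (Term.lam (Term.app Term.v1 (Term.app Term.succ Term.v0))))),
      fun f x => ?_⟩
    rw [Term.val_lam, Term.den_lam, Term.den_ite]
    simp only [Term.den_app, Term.den_wk, Term.den_v0, Term.den_v1, Term.den_fst, Term.den_snd,
      Term.val_lam, Term.den_pair, p1_trunc, p2_trunc, Ty.p1_mk, Ty.p2_mk, h]
    rcases nat_cases x with rfl | rfl | ⟨_ | i, rfl⟩
    · rfl
    · rfl
    · rfl
    · rw [natIte_succ, natTable_natVal]
      refine (natTable_natVal k _ i).trans ?_
      simp only [Nat.add_lt_add_iff_right]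
      rfl

/-- The code of `f` consists of its strictness answer, the value `f ⊥` and a table of `n` values.
Decoding branches on the answer: `0` selects the table, `1` selects `f ⊥`, while `⊥` and `⊤`
propagate, as they should for the constants `⊥` and `⊤`. The bound `2 ≤ n` makes the answers `0` and
`1` survive truncation. -/
theorem Retract.nat_arr_nat {n : ℕ} (hn : 2 ≤ n) :
    ∃ U, IsTuple U ∧ Retract n (Ty.arr Ty.nat Ty.nat) U := by
  obtain ⟨U, hU, R, S, h⟩ := exists_table n n
  refine ⟨Ty.prod Ty.nat (Ty.prod Ty.nat U), IsTuple.prod IsTuple.nat (IsTuple.prod IsTuple.nat hU),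
    Term.lam (Term.lam (Term.ite Ty.isGround_nat (Term.app Term.fst Term.v1)
      (Term.app (Term.app R.wk (Term.app Term.snd (Term.app Term.snd Term.v1))) Term.v0)
      (Term.app Term.fst (Term.app Term.snd Term.v1)))),
    Term.lam (Term.pair (Term.app Term.strictness.wk Term.v0)
      (Term.pair (Term.app Term.v0 Term.natBot.wk) (Term.app S.wk Term.v0))),
    fun f => Ty.arr_ext fun x => ?_⟩
  rw [Term.val_lam, Term.den_lam, Term.den_ite]
  simp only [Term.den_app, Term.den_wk, Term.den_v0, Term.den_v1, Term.den_fst, Term.den_snd,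
    Term.val_lam, Term.den_pair, p1_trunc, p2_trunc, Ty.p1_mk, Ty.p2_mk, trunc_arr, h,
    Term.natBot_val]
  rcases nat_hom_cases f with ⟨hb, ht⟩ | ⟨c, hc⟩
  · rw [Term.strictness_strict f hb ht, trunc_natVal (by omega), natIte_zero]
    rcases nat_cases x with rfl | rfl | ⟨i, rfl⟩
    · rw [trunc_bot_nat, hb, natTable_bot, trunc_bot_nat]
    · rw [trunc_top_nat, ht, natTable_top, trunc_top_nat]
    · rw [natTable_natVal]
      rcases lt_or_ge i n with hi | hi
      · rw [if_pos hi, trunc_natVal hi]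
      -- An argument outside the table is truncated to `⊥`, where a bistrict function gives `⊥`, in
      -- agreement with the default entry.
      · rw [if_neg hi.not_gt, trunc_natVal_of_le hi, hb, trunc_bot_nat]
  · rw [Term.strictness_const f c hc, hc, hc]
    rcases nat_cases c with rfl | rfl | ⟨k, rfl⟩
    · rfl
    · rfl
    · have h1 : natIte (T := Ty.nat) (natVal k) (natVal 1) (natVal 1) = natVal 1 := by
        cases k <;> rfl
      rw [h1, trunc_natVal (by omega), natIte_succ]

/-! ## Definability of truncated elements -/

/-- Codomain products split the function into two, and domain products are curried away, which
leaves `nat ⇒ nat`. The codomain has to vary in the induction on `U`, since after currying it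
becomes the code of the inner function type. -/
theorem Retract.tuple_arr {n : ℕ} (hn : 2 ≤ n) {U V : Ty} (hU : IsTuple U) (hV : IsTuple V) :
    ∃ W, IsTuple W ∧ Retract n (Ty.arr U V) W := by
  induction hU generalizing V with
  | nat =>
    induction hV with
    | nat => exact Retract.nat_arr_nat hn
    | prod _ _ ih1 ih2 =>
      obtain ⟨W, hW, h⟩ := ih1
      obtain ⟨W', hW', h'⟩ := ih2
      exact ⟨_, hW.prod hW', Retract.arr_prod.trans (h.prod h')⟩
  | prod _ _ ih1 ih2 =>
    obtain ⟨W, hW, h⟩ := ih2 hV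
    obtain ⟨W', hW', h'⟩ := ih1 hW
    exact ⟨W', hW', Retract.curry.trans ((Retract.refl.arr h).trans h')⟩

/-- Up to truncation, every type is a definable retract of a type of tuples of numbers. -/
theorem Retract.exists_tuple {n : ℕ} (hn : 2 ≤ n) : ∀ T : Ty, ∃ U, IsTuple U ∧ Retract n T U
  | Ty.sig => ⟨Ty.nat, IsTuple.nat, Retract.sig_nat⟩
  | Ty.nat => ⟨Ty.nat, IsTuple.nat, Retract.refl⟩
  | Ty.arr S T => by
    obtain ⟨U, hU, h⟩ := Retract.exists_tuple hn S
    obtain ⟨V, hV, h'⟩ := Retract.exists_tuple hn T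
    obtain ⟨W, hW, h''⟩ := Retract.tuple_arr hn hU hV
    exact ⟨W, hW, (h.arr h').trans h''⟩
  | Ty.prod S T => by
    obtain ⟨U, hU, h⟩ := Retract.exists_tuple hn S
    obtain ⟨V, hV, h'⟩ := Retract.exists_tuple hn T
    exact ⟨_, hU.prod hV, h.prod h'⟩

/-- No bound on the entries is required, because every number has a numeral. Truncation serves only
to make the tables finite. -/
theorem IsTuple.definable {U : Ty} (hU : IsTuple U) (x : U.Den) : ∃ M : Term [] U, M.val = x := by
  induction hU with
  | nat =>
    rcases nat_cases x with rfl | rfl | ⟨n, rfl⟩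
    · exact ⟨Term.natBot, Term.natBot_val⟩
    · exact ⟨Term.app Term.ofSig Term.top, Term.ofSig_top⟩
    · exact ⟨Term.num n, Term.den_num _ n⟩
  | prod _ _ ih1 ih2 =>
    obtain ⟨M, hM⟩ := ih1 (Ty.p1 x)
    obtain ⟨N, hN⟩ := ih2 (Ty.p2 x)
    exact ⟨Term.pair M N, Ty.prod_ext hM hN⟩

theorem trunc_definable {n : ℕ} (hn : 2 ≤ n) {T : Ty} (x : T.Den) :
    ∃ M : Term [] T, M.val = trunc n T x := by
  obtain ⟨U, hU, R, S, h⟩ := Retract.exists_tuple hn T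
  obtain ⟨M, hM⟩ := hU.definable (trunc n U (Ty.ap S.val x))
  exact ⟨Term.app R M, by rw [Term.val_app, hM, h]⟩

/-! ## Full abstraction -/

/-- The test for the number `n`. -/
def Term.isNum : ℕ → Term [] (Ty.arr Ty.nat Ty.sig)
  | 0 => Term.lam (Term.ite Ty.isGround_sig Term.v0 Term.top Term.bot)
  | n + 1 => Term.lam (Term.ite Ty.isGround_sig Term.v0 Term.bot
      (Term.app (Term.isNum n).wk (Term.app Term.pred Term.v0)))

theorem Term.isNum_eq_top (n : ℕ) (x : Ty.nat.Den) :
    Ty.ap (Term.isNum n).val x = Pointed.top ↔ x = natVal n ∨ x = Pointed.top := by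
  have hb : ∀ n, ¬ ((Pointed.bot : Ty.nat.Den) = natVal n ∨ Pointed.bot = Pointed.top) :=
    fun n h => h.elim (fun h => natVal_ne_bot n h.symm) nat_bot_ne_top
  have hv : ∀ {m n}, m ≠ n → ¬ (natVal m = natVal n ∨ natVal m = Pointed.top) :=
    fun hmn h => h.elim (fun h => hmn (natVal_inj.1 h)) (natVal_ne_top _)
  induction n generalizing x with
  | zero =>
    rw [Term.isNum, Term.val_lam, Term.den_ite, Term.den_v0]
    rcases nat_cases x with rfl | rfl | ⟨_ | k, rfl⟩
    · exact iff_of_false sig_bot_ne_top (hb 0)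
    · exact iff_of_true rfl (Or.inr rfl)
    · exact iff_of_true rfl (Or.inl rfl)
    · exact iff_of_false sig_bot_ne_top (hv k.succ_ne_zero)
  | succ n ih =>
    rw [Term.isNum, Term.val_lam, Term.den_ite, Term.den_app, Term.den_app, Term.den_wk,
      Term.den_v0]
    rcases nat_cases x with rfl | rfl | ⟨_ | k, rfl⟩
    · exact iff_of_false sig_bot_ne_top (hb (n + 1))
    · exact iff_of_true rfl (Or.inr rfl)
    · exact iff_of_false sig_bot_ne_top (hv n.succ_ne_zero.symm)
    -- At `k + 1` the test takes the second branch and tests the predecessor `k`.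
    · refine (ih (natVal k)).trans ?_
      rw [natVal_inj, natVal_inj, Nat.add_right_cancel_iff]
      exact or_congr_right (iff_of_false (natVal_ne_top _) (natVal_ne_top _))

/-- Elements that are not related by the order are separated by a closed term. -/
theorem exists_test : ∀ (T : Ty) (x y : T.Den), ¬ x ≤ y → ∃ F : Term [] (Ty.arr T Ty.sig),
    Ty.ap F.val x = Pointed.top ∧ Ty.ap F.val y ≠ Pointed.top
  | Ty.sig, x, y, h => by
    refine ⟨Term.lam Term.v0, ?_, fun hy => h ?_⟩
    · exact (sig_cases x).resolve_left fun hx => h (hx ▸ Pointed.bot_le y)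
    · exact (show y = Pointed.top from hy) ▸ Pointed.le_top x
  | Ty.nat, x, y, h => by
    rw [nat_le_iff, not_or, not_or] at h
    obtain ⟨hx, hy, hxy⟩ := h
    -- The test for `n` also accepts `⊤`. If `x` is `⊤`, any number different from `y` will do, and
    -- one of `0` and `1` is.
    have key : ∃ n : ℕ, (x = natVal n ∨ x = Pointed.top) ∧ ¬ (y = natVal n ∨ y = Pointed.top) := by
      rcases nat_cases x with rfl | rfl | ⟨n, rfl⟩
      · exact absurd rfl hx
      · by_cases h0 : y = natVal 0
        · refine ⟨1, Or.inr rfl, not_or.2 ⟨fun h1 => ?_, hy⟩⟩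
          exact absurd (natVal_inj.1 (h0.symm.trans h1)) zero_ne_one
        · exact ⟨0, Or.inr rfl, not_or.2 ⟨h0, hy⟩⟩
      · exact ⟨n, Or.inl rfl, not_or.2 ⟨fun h => hxy h.symm, hy⟩⟩
    obtain ⟨n, h1, h2⟩ := key
    exact ⟨Term.isNum n, (Term.isNum_eq_top n x).2 h1, fun h => h2 ((Term.isNum_eq_top n y).1 h)⟩
  | Ty.prod S T, x, y, h => by
    by_cases h1 : Ty.p1 x ≤ Ty.p1 y
    · obtain ⟨F, hx, hy⟩ := exists_test T (Ty.p2 x) (Ty.p2 y) fun h2 => h ⟨h1, h2⟩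
      refine ⟨Term.lam (Term.app F.wk (Term.app Term.snd Term.v0)), ?_⟩
      simp only [Term.val_lam, Term.den_app, Term.den_wk, Term.den_v0, Term.den_snd]
      exact ⟨hx, hy⟩
    · obtain ⟨F, hx, hy⟩ := exists_test S (Ty.p1 x) (Ty.p1 y) h1
      refine ⟨Term.lam (Term.app F.wk (Term.app Term.fst Term.v0)), ?_⟩
      simp only [Term.val_lam, Term.den_app, Term.den_wk, Term.den_v0, Term.den_fst]
      exact ⟨hx, hy⟩
  | Ty.arr S T, f, g, h => by
    -- By continuity of `f`, inequalities at all truncated arguments would give `f ≤ g`. The index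
    -- is shifted by `2` to meet the bound in `trunc_definable`; the shifted chain is still cofinal.
    have key : ∃ (n : ℕ) (a : S.Den),
        ¬ Ty.ap f (trunc (n + 2) S a) ≤ Ty.ap g (trunc (n + 2) S a) := by
      by_contra! hle
      refine h fun a => ?_
      obtain ⟨hm, hl⟩ := trunc_spec S a
      refine (Hom.cont (A := S.Den) (B := T.Den) f (Set.range_nonempty fun n => trunc n S a)
        (directedOn_range.2 (directed_of_isDirected_le hm)) hl).2 ?_
      rintro _ ⟨_, ⟨n, rfl⟩, rfl⟩
      exact (Hom.mono (A := S.Den) (B := T.Den) f (hm (Nat.le_add_right n 2))).trans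
        ((hle n a).trans (Hom.mono (A := S.Den) (B := T.Den) g (hl.1 ⟨n + 2, rfl⟩)))
    obtain ⟨n, a, ha⟩ := key
    obtain ⟨M, hM⟩ := trunc_definable (Nat.le_add_left 2 n) a
    rw [← hM] at ha
    obtain ⟨F, hx, hy⟩ := exists_test T _ _ ha
    refine ⟨Term.lam (Term.app F.wk (Term.app Term.v0 M.wk)), ?_⟩
    simp only [Term.val_lam, Term.den_app, Term.den_wk, Term.den_v0]
    exact ⟨hx, hy⟩

/-! ### Program contexts and the passage from closed to open terms. -/

theorem Ctx.den_mono {Γ Δ : List Ty} {T A : Ty} (C : Ctx Γ T Δ A) {M N : Term Γ T}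
    (h : M.den ≤ N.den) : (C.fill M).den ≤ (C.fill N).den := by
  induction C with
  | hole => exact h
  | lam C ih => exact fun γ a => ih (CtxDen.cons γ a)
  | appL C P ih => exact fun γ => ih γ (P.den γ)
  | appR P C ih => exact fun γ => Hom.mono (P.den γ) (ih γ)
  | pairL C P ih => exact fun γ => ⟨ih γ, le_rfl⟩
  | pairR P C ih => exact fun γ => ⟨le_rfl, ih γ⟩

/-- `C[λx.[·]]`. -/
def Ctx.compLam {Γ : List Ty} {S T : Ty} : {Δ : List Ty} → {A : Ty} →
    Ctx Γ (Ty.arr S T) Δ A → Ctx (S :: Γ) T Δ A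
  | _, _, Ctx.hole => Ctx.lam Ctx.hole
  | _, _, Ctx.lam C => Ctx.lam C.compLam
  | _, _, Ctx.appL C N => Ctx.appL C.compLam N
  | _, _, Ctx.appR N C => Ctx.appR N C.compLam
  | _, _, Ctx.pairL C N => Ctx.pairL C.compLam N
  | _, _, Ctx.pairR N C => Ctx.pairR N C.compLam

theorem Ctx.fill_compLam {Γ Δ : List Ty} {S T A : Ty} (C : Ctx Γ (Ty.arr S T) Δ A)
    (M : Term (S :: Γ) T) : C.compLam.fill M = C.fill (Term.lam M) := by
  induction C with
  | hole => rfl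
  | lam C ih => exact congrArg Term.lam ih
  | appL C N ih => exact congrArg (fun P => Term.app P N) ih
  | appR N C ih => exact congrArg (Term.app N) ih
  | pairL C N ih => exact congrArg (fun P => Term.pair P N) ih
  | pairR N C ih => exact congrArg (Term.pair N) ih

/-- A context around the abstraction is a context around its body that captures the bound variable.
-/
theorem ObsLe.lam {Γ : List Ty} {S T : Ty} {M N : Term (S :: Γ) T} (h : ObsLe M N) :
    ObsLe (Term.lam M) (Term.lam N) := fun C hC => by
  rw [← Ctx.fill_compLam] at hC ⊢
  exact h _ hC

/-- Abstracting the variables one at a time leads to the empty context. There a separating term `F`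
gives the context `F [·]`, in which `M` would converge and `N` would not. -/
theorem ObsLe.den_le : ∀ {Γ : List Ty} {T : Ty} {M N : Term Γ T}, ObsLe M N → M.den ≤ N.den
  | [], T, M, N, h => by
    rintro ⟨⟩
    by_contra hle
    obtain ⟨F, hM, hN⟩ := exists_test T M.val N.val hle
    exact hN ((converges_iff _).1 (h (Ctx.appR F Ctx.hole) ((converges_iff _).2 hM)))
  | _ :: _, _, _, _, h => fun γ => h.lam.den_le γ.1 γ.2

end SPCF

theorem mainTheorem7 (Γ : List SPCF.Ty) (T : SPCF.Ty) (M N : SPCF.Term Γ T) :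
    SPCF.ObsLe M N ↔ M.den ≤ N.den := by
  refine ⟨SPCF.ObsLe.den_le, fun h C hC => (SPCF.converges_iff _).2 ?_⟩
  have hM := (SPCF.converges_iff _).1 hC
  have hle : (C.fill M).val ≤ (C.fill N).val := C.den_mono h SPCF.CtxDen.nil
  exact le_antisymm (SPCF.Pointed.le_top _) (hM.ge.trans hle)
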